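/- Let $G$ be a connected, simply-connected, complex semisimple Lie group (equivalently, a connected, simply-connected, complex semisimple linear algebraic group), with Lie algebra $\mathfrak g$, Killing form $\langle\cdot,\cdot\rangle$, adjoint representation $\mathrm{Ad}$ and coadjoint representation $\mathrm{Ad}^*_g(\alpha)=\alpha\circ\mathrm{Ad}_{g^{-1}}$. For $x\in\mathfrak g$ put $x^\vee:=\langle x,\cdot\rangle\in\mathfrak g^*$. Let $\omega_{T^*G}=-d\theta$ be the canonical holomorphic symplectic form on $T^*G$, where $\theta$ is the tautological $1$-form, $\theta_\alpha(v)=\alpha(d\pi(v))$ with $\pi:T^*G\to G$ the projection. Let $R_g$ denote right multiplication by $g$, let $$\Psi:G\times\mathfrak g\to T^*G,\qquad \Psi(g,x)=\big(g,\;x^\vee\circ(d_eR_g)^{-1}\big),$$ and let $\omega:=\Psi^*\omega_{T^*G}$. Let $\xi,h,\eta\in\mathfrak g$ be an $\mathfrak{sl}_2(\mathbb C)$-triple, i.e. $[\xi,\eta]=h$, $[h,\xi]=2\xi$, $[h,\eta]=-2\eta$, and let $S(\xi,h,\eta):=\xi+\{z\in\mathfrak g:[\eta,z]=0\}$ be its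 Slodowy slice. Equip $G\times S(\xi,h,\eta)$ with the restriction of $\omega$, and let $G$ act on it by $$a\cdot(g,x):=(ga^{-1},x),\qquad a,g\in G,\ x\in S(\xi,h,\eta).$$ Then the restriction of $\omega$ to $G\times S(\xi,h,\eta)$ is a holomorphic symplectic form (holomorphic, closed and non-degenerate), the action is a Hamiltonian holomorphic action for it, and $$\mu:G\times S(\xi,h,\eta)\to\mathfrak g^*,\qquad \mu(g,x)=-\mathrm{Ad}^*_{g^{-1}}(x^\vee),$$ is a moment map. Here a moment map for a holomorphic action of $G$ on a holomorphic symplectic manifold $(X,\sigma)$ is a holomorphic map $\mu:X\to\mathfrak g^*$ with $\mu(a\cdot p)=\mathrm{Ad}^*_a(\mu(p))$ for all $a\in G$, $p\in X$, and with $d\langle\mu,y\rangle=\sigma(X_y,\cdot)$ for all $y\in\mathfrak g$, where $X_y(p)=\frac{d}{dt}\big|_{t=0}\exp(ty)\cdot p$; the action is Hamiltonian if it preserves $\sigma$ and admits a moment map. -/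

import Mathlib

open scoped Manifold ContDiff Bundle

noncomputable section

/-! ### Holomorphic differential forms on complex manifolds

Complex manifolds are modelled, without boundary, on a complex normed space `F`. -/

section Forms

variable {F : Type*} [NormedAddCommGroup F] [NormedSpace ℂ F]
  {H : Type*} [TopologicalSpace H] (I : ModelWithCorners ℂ F H)
  {F' : Type*} [NormedAddCommGroup F'] [NormedSpace ℂ F']
  {H' : Type*} [TopologicalSpace H'] (I' : ModelWithCorners ℂ F' H')
  {X : Type*} [TopologicalSpace X] [ChartedSpace H X]
  {Y : Type*} [TopologicalSpace Y] [ChartedSpace H' Y]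

/-- A (not necessarily holomorphic) form of type `(k, 0)` on `X`: a `ℂ`-multilinear alternating
form on every holomorphic tangent space. -/
abbrev DiffForm (X : Type*) [TopologicalSpace X] [ChartedSpace H X] (k : ℕ) :=
  (p : X) → TangentSpace I p [⋀^Fin k]→L[ℂ] ℂ

variable {I I'}

/-- The pull-back `f^* α`. -/
def DiffForm.pullback {k : ℕ} (f : X → Y) (α : DiffForm I' Y k) : DiffForm I X k :=
  fun p => (α (f p)).compContinuousLinearMap (mfderiv I I' f p)

/-- The expression of a form in the chart around `p`: the pull-back of the form under the inverse
of the chart (relevant only on the target of the chart, which is open in `F`). -/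
def DiffForm.inChart {k : ℕ} (α : DiffForm I X k) (p : X) : F → F [⋀^Fin k]→L[ℂ] ℂ :=
  fun u => DiffForm.pullback (I := 𝓘(ℂ, F)) (I' := I) (extChartAt I p).symm α u

/-- A form is holomorphic if its expressions in charts are analytic. -/
def DiffForm.IsHolomorphic {k : ℕ} (α : DiffForm I X k) : Prop :=
  ∀ p : X, AnalyticAt ℂ (α.inChart p) (extChartAt I p p)

/-- The exterior derivative, computed at `p` in the chart around `p`. -/
def DiffForm.extDer {k : ℕ} (α : DiffForm I X k) : DiffForm I X (k + 1) :=
  fun p => (extDeriv (α.inChart p) (extChartAt I p p)).compContinuousLinearMap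
    (mfderiv I 𝓘(ℂ, F) (extChartAt I p) p : TangentSpace I p →L[ℂ] F)

/-- Holomorphic symplectic forms: holomorphic, closed, non-degenerate 2-forms. -/
structure IsHolomorphicSymplectic [I.Boundaryless] [IsManifold I ω X] (σ : DiffForm I X 2) : Prop where
  holomorphic : σ.IsHolomorphic
  closed : σ.extDer = 0
  nondegenerate : ∀ (p : X) (v : TangentSpace I p),
    (∀ w : TangentSpace I p, σ p ![v, w] = 0) → v = 0

end Forms

/-! ### The cotangent bundle and its holomorphic symplectic form -/

section Cotangent

variable (E : Type*) [NormedAddCommGroup E] [NormedSpace ℂ E]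
  (X : Type*) [TopologicalSpace X] [ChartedSpace E X]

/-- The holomorphic cotangent bundle `T^*X`. -/
abbrev CotangentBundle [IsManifold 𝓘(ℂ, E) 1 X] :=
  Bundle.TotalSpace (E →L[ℂ] ℂ)
    (fun p : X => TangentSpace 𝓘(ℂ, E) p →L[ℂ] Bundle.Trivial X ℂ p)

variable [IsManifold 𝓘(ℂ, E) 1 X]

/-- The tautological 1-form `θ` of `T^*X`: `θ_α(v) = α(dπ(v))`. -/
def tautologicalForm :
    DiffForm (𝓘(ℂ, E).prod 𝓘(ℂ, E →L[ℂ] ℂ)) (CotangentBundle E X) 1 :=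
  fun α => ContinuousAlternatingMap.ofSubsingleton ℂ _ ℂ (0 : Fin 1)
    (ContinuousLinearMap.comp (α.2 : TangentSpace 𝓘(ℂ, E) α.1 →L[ℂ] ℂ)
      (mfderiv (𝓘(ℂ, E).prod 𝓘(ℂ, E →L[ℂ] ℂ)) 𝓘(ℂ, E)
        (fun β : CotangentBundle E X => β.1) α))

/-- The canonical symplectic form `-dθ` of `T^*X` (`∑ dqᵢ ∧ dpᵢ` in cotangent coordinates). -/
def cotangentForm :
    DiffForm (𝓘(ℂ, E).prod 𝓘(ℂ, E →L[ℂ] ℂ)) (CotangentBundle E X) 2 :=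
  fun α => -(tautologicalForm E X).extDer α

end Cotangent

/-! ### Complex Lie groups and their Lie algebras -/

section LieGroups

variable {E : Type*} [NormedAddCommGroup E] [NormedSpace ℂ E]
  {G : Type*} [TopologicalSpace G] [ChartedSpace E G] [Group G]

instance completeSpace_of_finiteDimensional_complex [FiniteDimensional ℂ E] : CompleteSpace E :=
  FiniteDimensional.complete ℂ E

/-- The Lie algebra is the tangent space at the identity, so a copy of the model space `E`; it
carries the norm of `E`. (The topology is written out so as to be syntactically that of the
tangent space.) -/
instance normedAddCommGroup_lie : NormedAddCommGroup (GroupLieAlgebra 𝓘(ℂ, E) G) where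
  toAddCommGroup := inferInstance
  norm x := norm (E := E) x
  dist x y := dist (α := E) x y
  dist_self x := dist_self (α := E) x
  dist_comm x y := dist_comm (α := E) x y
  dist_triangle := dist_triangle (α := E)
  eq_of_dist_eq_zero := eq_of_dist_eq_zero (γ := E)
  edist x y := edist (α := E) x y
  edist_dist x y := edist_dist (α := E) x y
  toUniformSpace :=
    { toTopologicalSpace := inferInstance
      uniformity := uniformity E
      symm := UniformSpace.symm (α := E)
      comp := UniformSpace.comp (α := E)
      nhds_eq_comap_uniformity := UniformSpace.nhds_eq_comap_uniformity (α := E) }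
  uniformity_dist := PseudoMetricSpace.uniformity_dist (α := E)
  toBornology := inferInstanceAs (Bornology E)
  cobounded_sets := PseudoMetricSpace.cobounded_sets (α := E)
  dist_eq x y := dist_eq_norm_neg_add (E := E) x y
instance normedSpace_lie : NormedSpace ℂ (GroupLieAlgebra 𝓘(ℂ, E) G) where
  toModule := inferInstance
  norm_smul_le c x := NormedSpace.norm_smul_le (E := E) c x

instance finiteDimensional_lie [FiniteDimensional ℂ E] : FiniteDimensional ℂ (GroupLieAlgebra 𝓘(ℂ, E) G) :=
  inferInstanceAs (FiniteDimensional ℂ E)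

/-- The adjoint representation: `Ad_g` is the derivative at the identity of `a ↦ g a g⁻¹`. -/
def Ad (g : G) : GroupLieAlgebra 𝓘(ℂ, E) G →L[ℂ] GroupLieAlgebra 𝓘(ℂ, E) G :=
  mfderiv 𝓘(ℂ, E) 𝓘(ℂ, E) (fun a : G => g * a * g⁻¹) 1

/-- The coadjoint representation: `Ad^*_g(α) = α ∘ Ad_{g⁻¹}`. -/
def coAd (g : G) (α : Module.Dual ℂ (GroupLieAlgebra 𝓘(ℂ, E) G)) :
    Module.Dual ℂ (GroupLieAlgebra 𝓘(ℂ, E) G) :=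
  α ∘ₗ (Ad g⁻¹).toLinearMap

/-- The differential at the identity of the right multiplication `R_g : a ↦ a g`. -/
def rightDifferential (g : G) :
    GroupLieAlgebra 𝓘(ℂ, E) G →L[ℂ] TangentSpace 𝓘(ℂ, E) g :=
  mfderiv 𝓘(ℂ, E) 𝓘(ℂ, E) (fun a : G => a * g) 1

/-- The element `x^∨ = ⟨x, ·⟩` of the dual given by the Killing form. -/
def killingDual [FiniteDimensional ℂ E] [LieGroup 𝓘(ℂ, E) ω G]
    (x : GroupLieAlgebra 𝓘(ℂ, E) G) : Module.Dual ℂ (GroupLieAlgebra 𝓘(ℂ, E) G) :=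
  killingForm ℂ (GroupLieAlgebra 𝓘(ℂ, E) G) x

/-! ### Hamiltonian actions -/

variable {F : Type*} [NormedAddCommGroup F] [NormedSpace ℂ F]
  {H : Type*} [TopologicalSpace H] {J : ModelWithCorners ℂ F H}
  {X : Type*} [TopologicalSpace X] [ChartedSpace H X]

variable (E J) in
/-- Holomorphic left actions of `G` on `X`. -/
structure IsHolomorphicAction (a : G → X → X) : Prop where
  one_act : ∀ p, a 1 p = p
  mul_act : ∀ g h p, a (g * h) p = a g (a h p)
  holomorphic : ContMDiff (𝓘(ℂ, E).prod J) J ω (fun q : G × X => a q.1 q.2)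

variable (J) in
/-- The fundamental vector field of `y` for an action `a`: its value at `p` is
`d/dt|_{t = 0} exp(t y) · p`, the image of `y` under the differential at the identity of the
orbit map `g ↦ g · p`. -/
def fundamentalVectorField (a : G → X → X) (y : GroupLieAlgebra 𝓘(ℂ, E) G) (p : X) :
    TangentSpace J p :=
  mfderiv 𝓘(ℂ, E) J (fun g : G => a g p) 1 y

/-- Moment maps: `μ : X → 𝔤^*` is holomorphic and equivariant for the coadjoint representation,
and `d⟨μ, y⟩ = σ(X_y, ·)` for all `y`, with `X_y` the fundamental vector field of `y`. -/
structure IsMomentMap (σ : DiffForm J X 2) (a : G → X → X)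
    (μ : X → Module.Dual ℂ (GroupLieAlgebra 𝓘(ℂ, E) G)) : Prop where
  holomorphic : ∀ y : GroupLieAlgebra 𝓘(ℂ, E) G, ContMDiff J 𝓘(ℂ, ℂ) ω (fun p => μ p y)
  equivariant : ∀ (g : G) (p : X), μ (a g p) = coAd g (μ p)
  differential : ∀ (y : GroupLieAlgebra 𝓘(ℂ, E) G) (p : X) (v : TangentSpace J p),
    (mfderiv J 𝓘(ℂ, ℂ) (fun q => μ q y) p v : ℂ) = σ p ![fundamentalVectorField J a y p, v]

variable (E) in
/-- Hamiltonian actions on the holomorphic symplectic manifold `(X, σ)`: holomorphic actions by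
symplectomorphisms that have a moment map. -/
structure IsHamiltonianAction [J.Boundaryless] [IsManifold J ω X] (σ : DiffForm J X 2)
    (a : G → X → X) :
    Prop where
  symplectic : IsHolomorphicSymplectic σ
  action : IsHolomorphicAction E J a
  invariant : ∀ g : G, DiffForm.pullback (a g) σ = σ
  exists_momentMap :
    ∃ μ : X → Module.Dual ℂ (GroupLieAlgebra 𝓘(ℂ, E) G), IsMomentMap σ a μ

/-! ### The symplectic form on `G × 𝔤` -/

section

variable [FiniteDimensional ℂ E] [LieGroup 𝓘(ℂ, E) ω G]

/-- The isomorphism `Ψ : G × 𝔤 → T^*G`, `(g, x) ↦ (g, x^∨ ∘ (d_e R_g)⁻¹)`. -/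
def cotangentTrivialization (q : G × GroupLieAlgebra 𝓘(ℂ, E) G) : CotangentBundle E G :=
  ⟨q.1, (LinearMap.toContinuousLinearMap (killingDual q.2)).comp
    (rightDifferential (E := E) q.1).inverse⟩

variable (E G) in
/-- The holomorphic symplectic form `Ψ^* ω_{T^*G}` on `G × 𝔤`. -/
def groupAlgebraForm :
    DiffForm (𝓘(ℂ, E).prod 𝓘(ℂ, GroupLieAlgebra 𝓘(ℂ, E) G))
      (G × GroupLieAlgebra 𝓘(ℂ, E) G) 2 :=
  DiffForm.pullback cotangentTrivialization (cotangentForm E G)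

/-! ### Slodowy slices -/

/-- The relations of an `𝔰𝔩₂`-triple `(ξ, h, η)`; the zero triple is allowed. -/
structure IsSl2TripleRel (ξ h η : GroupLieAlgebra 𝓘(ℂ, E) G) : Prop where
  lie_xi_eta : ⁅ξ, η⁆ = h
  lie_h_xi : ⁅h, ξ⁆ = (2 : ℂ) • ξ
  lie_h_eta : ⁅h, η⁆ = (-2 : ℂ) • η

/-- The centralizer `Z_𝔤(x) = {y : [x, y] = 0}`. -/
abbrev lieCentralizer (x : GroupLieAlgebra 𝓘(ℂ, E) G) :
    Submodule ℂ (GroupLieAlgebra 𝓘(ℂ, E) G) :=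
  LinearMap.ker (LieAlgebra.ad ℂ (GroupLieAlgebra 𝓘(ℂ, E) G) x)

/-- The Slodowy slice `ξ + Z_𝔤(η)`. It does not involve the element `h` of the triple. -/
def slodowySlice (ξ η : GroupLieAlgebra 𝓘(ℂ, E) G) : Set (GroupLieAlgebra 𝓘(ℂ, E) G) :=
  {x | ∃ z ∈ lieCentralizer η, x = ξ + z}

/-- The global chart `x ↦ x - ξ` of the Slodowy slice. -/
def slodowyChart (ξ η : GroupLieAlgebra 𝓘(ℂ, E) G) :
    slodowySlice ξ η ≃ₜ lieCentralizer η where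
  toFun x := ⟨x.1 - ξ, by
    obtain ⟨z, hz, hx⟩ := x.2
    rw [hx, add_sub_cancel_left]
    exact hz⟩
  invFun z := ⟨ξ + z.1, z.1, z.2, rfl⟩
  left_inv x := by ext; simp
  right_inv z := by ext; simp
  continuous_toFun := by fun_prop
  continuous_invFun := by fun_prop

instance chartedSpace_slodowySlice (ξ η : GroupLieAlgebra 𝓘(ℂ, E) G) :
    ChartedSpace (lieCentralizer η) (slodowySlice ξ η) :=
  (slodowyChart ξ η).toOpenPartialHomeomorph.singletonChartedSpace rfl

instance isManifold_slodowySlice (ξ η : GroupLieAlgebra 𝓘(ℂ, E) G) :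
    IsManifold 𝓘(ℂ, lieCentralizer η) ω (slodowySlice ξ η) where
  toHasGroupoid := (slodowyChart ξ η).toOpenPartialHomeomorph.singleton_hasGroupoid rfl _

/-- The restriction of the symplectic form of `G × 𝔤` to `G × S(ξ, h, η)`: its pull-back under the
inclusion. -/
def slodowyForm (ξ η : GroupLieAlgebra 𝓘(ℂ, E) G) :
    DiffForm (𝓘(ℂ, E).prod 𝓘(ℂ, lieCentralizer η)) (G × slodowySlice ξ η) 2 :=
  DiffForm.pullback (fun q => (q.1, (q.2 : GroupLieAlgebra 𝓘(ℂ, E) G))) (groupAlgebraForm E G)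

/-- The action `h · (g, x) = (g h⁻¹, x)` of `G` on `G × S(ξ, h, η)`. -/
def slodowyAction (ξ η : GroupLieAlgebra 𝓘(ℂ, E) G) (h : G) (q : G × slodowySlice ξ η) :
    G × slodowySlice ξ η :=
  (q.1 * h⁻¹, q.2)

/-- The map `μ(g, x) = -Ad^*_{g⁻¹}(x^∨)`. -/
def slodowyMomentMap (ξ η : GroupLieAlgebra 𝓘(ℂ, E) G) (q : G × slodowySlice ξ η) :
    Module.Dual ℂ (GroupLieAlgebra 𝓘(ℂ, E) G) :=
  -coAd q.1⁻¹ (killingDual q.2.1)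

end

end LieGroups

end

open scoped Topology

noncomputable section

/-! ### Calculus of holomorphic forms: pull-back, naturality of `d`, `d² = 0` -/

section ExtDeriv

variable {𝕜 V W : Type*} [NontriviallyNormedField 𝕜] [NormedAddCommGroup V] [NormedSpace 𝕜 V]
  [NormedAddCommGroup W] [NormedSpace 𝕜 W] [CompleteSpace W] {k : ℕ}

/-! Write a tangent vector of `G × S` at `(g, x)` as `(u, ζ)`, where `u` is its group component
moved to the identity by `R_{g⁻¹}`. The tautological form pulls back to the 1-form `(u, ζ) ↦ ⟨x,
u⟩`, and `ω` is minus its exterior derivative. Holomorphy and closedness of `ω` therefore follow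
from naturality of `d` and `d² = 0`. Right translations of `G` preserve the 1-form, hence `ω`.

By invariance `ω` need only be computed at `g = 1`. Cartan's formula on right-invariant fields,
whose bracket is minus the Lie algebra bracket, gives `ω((u, ζ), (u', ζ')) = ⟨ζ', u⟩ - ⟨ζ, u'⟩ - ⟨x,
[u, u']⟩` (`slodowyForm_apply`).

Moment map: the fundamental field of `y` is `(-Ad_g y, 0)` in this trivialization and `⟨μ, y⟩ = -⟨x,
Ad_g y⟩`. Since the differential of `Ad` is `ad`, the two sides of the moment map equation agree
term by term.

Nondegeneracy: if `(u, ζ)` is in the kernel, testing against `(0, z)` with `z ∈ Z(η)` gives `u ∈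
Z(η)^⊥ = im ad η`, and testing against `(u', 0)` gives `ζ = -[x, u]`, so `[η, [x, u]] = 0`. On the
slice `[x, η] = h`, and `ad η ∘ ad x` is injective on `im ad η` by an `𝔰𝔩₂` weight argument
(`apply_eq_zero_of_commutator`). Hence `u = 0`, and then `ζ = 0`.

Tangent spaces are treated throughout as copies of `E`, so that differentials at points such as `g *
g⁻¹` and `1` can be compared without transport. -/

set_option synthInstance.maxHeartbeats 400000 in
theorem AnalyticAt.extDeriv {α : V → V [⋀^Fin k]→L[𝕜] W} {x : V} (hα : AnalyticAt 𝕜 α x) :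
    AnalyticAt 𝕜 (extDeriv α) x := by
  let T := ContinuousAlternatingMap.alternatizeUncurryFinCLM 𝕜 V W (n := k)
  have h : AnalyticAt 𝕜 (fun y => T (fderiv 𝕜 α y)) x :=
    (T.analyticAt (fderiv 𝕜 α x)).fun_comp hα.fderiv
  exact h

end ExtDeriv

section PullbackForms

variable {F : Type*} [NormedAddCommGroup F] [NormedSpace ℂ F]
  {H : Type*} [TopologicalSpace H] {I : ModelWithCorners ℂ F H}
  {F' : Type*} [NormedAddCommGroup F'] [NormedSpace ℂ F']
  {H' : Type*} [TopologicalSpace H'] {I' : ModelWithCorners ℂ F' H'}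
  {F'' : Type*} [NormedAddCommGroup F''] [NormedSpace ℂ F'']
  {H'' : Type*} [TopologicalSpace H''] {I'' : ModelWithCorners ℂ F'' H''}
  {X : Type*} [TopologicalSpace X] [ChartedSpace H X]
  {Y : Type*} [TopologicalSpace Y] [ChartedSpace H' Y]
  {Z : Type*} [TopologicalSpace Z] [ChartedSpace H'' Z]
  {k : ℕ}

theorem DiffForm.compContinuousLinearMap_congr (α : DiffForm I' Y k) {y y' : Y} (h : y = y')
    {A A' : F →L[ℂ] F'} (hA : A = A') :
    (α y : F' [⋀^Fin k]→L[ℂ] ℂ).compContinuousLinearMap A =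
      (α y' : F' [⋀^Fin k]→L[ℂ] ℂ).compContinuousLinearMap A' := by
  subst h hA
  rfl

theorem DiffForm.pullback_congr_of_eventuallyEq (α : DiffForm I' Y k) {f g : X → Y} {p : X}
    (h : f =ᶠ[𝓝 p] g) :
    DiffForm.pullback (I := I) f α p = DiffForm.pullback (I := I) g α p :=
  DiffForm.compContinuousLinearMap_congr (F := F) α h.eq_of_nhds h.mfderiv_eq

theorem DiffForm.pullback_comp_apply (α : DiffForm I'' Z k) {g : Y → Z} {f : X → Y} {p : X}
    (hg : MDifferentiableAt I' I'' g (f p)) (hf : MDifferentiableAt I I' f p) :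
    DiffForm.pullback (I := I) (g ∘ f) α p = DiffForm.pullback (I := I) f (DiffForm.pullback (I := I') g α) p := by
  unfold DiffForm.pullback
  rw [mfderiv_comp p hg hf]
  rfl

theorem DiffForm.pullback_comp (α : DiffForm I'' Z k) {g : Y → Z} {f : X → Y}
    (hg : MDifferentiable I' I'' g) (hf : MDifferentiable I I' f) :
    DiffForm.pullback (I := I) (g ∘ f) α = DiffForm.pullback (I := I) f (DiffForm.pullback (I := I') g α) :=
  funext fun p => α.pullback_comp_apply (hg _) (hf p)

variable [IsManifold I ω X] [IsManifold I' ω Y]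

theorem DiffForm.extDer_apply (α : DiffForm I X k) (p : X) :
    α.extDer p = extDeriv (α.inChart p) (extChartAt I p p) := by
  unfold DiffForm.extDer
  rw [mfderiv_extChartAt_self]
  ext v
  rfl

variable [I.Boundaryless] [I'.Boundaryless]

theorem contMDiffAt_extChartAt_symm_of_boundaryless {p : X} {u : F}
    (hu : u ∈ (extChartAt I p).target) :
    ContMDiffAt 𝓘(ℂ, F) I ω (extChartAt I p).symm u :=
  (contMDiffOn_extChartAt_symm p).contMDiffAt ((isOpen_extChartAt_target p).mem_nhds hu)

omit [I'.Boundaryless] [IsManifold I ω X] [IsManifold I' ω Y] in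
theorem contDiffAt_writtenInExtChartAt {f : X → Y} {p : X} (hf : ContMDiffAt I I' ω f p) :
    ContDiffAt ℂ ω (writtenInExtChartAt I I' p f) (extChartAt I p p) := by
  have := (contMDiffAt_iff.mp hf).2
  rwa [I.range_eq_univ, contDiffWithinAt_univ] at this

omit [I'.Boundaryless] [IsManifold I ω X] [IsManifold I' ω Y] in
theorem mfderiv_eq_fderiv_writtenInExtChartAt {f : X → Y} {p : X}
    (hf : MDifferentiableAt I I' f p) :
    mfderiv I I' f p = fderiv ℂ (writtenInExtChartAt I I' p f) (extChartAt I p p) := by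
  refine (if_pos hf).trans ?_
  rw [I.range_eq_univ, fderivWithin_univ]

/-- Composition is analytic as a map into multilinear maps. In finite dimension the inclusion of
alternating maps into multilinear maps has a continuous linear left inverse, which carries
analyticity back. -/
theorem analyticAt_compContinuousLinearMap {V : Type*} [NormedAddCommGroup V] [NormedSpace ℂ V]
    [FiniteDimensional ℂ F] {a : V → F' [⋀^Fin k]→L[ℂ] ℂ} {A : V → F →L[ℂ] F'}
    {x : V} (ha : AnalyticAt ℂ a x) (hA : AnalyticAt ℂ A x) :
    AnalyticAt ℂ (fun y => (a y).compContinuousLinearMap (A y)) x := by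
  have hfin : FiniteDimensional ℂ (ContinuousMultilinearMap ℂ (fun _ : Fin k => F) ℂ) :=
    Module.Finite.of_injective (ContinuousMultilinearMap.toMultilinearMapLinear :
        ContinuousMultilinearMap ℂ (fun _ : Fin k => F) ℂ →ₗ[ℂ] _)
      ContinuousMultilinearMap.toMultilinearMap_injective
  let T : (F [⋀^Fin k]→L[ℂ] ℂ) →L[ℂ] ContinuousMultilinearMap ℂ (fun _ : Fin k => F) ℂ :=
    ContinuousAlternatingMap.toContinuousMultilinearMapCLM ℂ
  obtain ⟨S, hS⟩ := LinearMap.exists_leftInverse_of_injective T.toLinearMap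
    (LinearMap.ker_eq_bot.mpr ContinuousAlternatingMap.toContinuousMultilinearMap_injective)
  let S' := LinearMap.toContinuousLinearMap S
  let T' : (F' [⋀^Fin k]→L[ℂ] ℂ) →L[ℂ] ContinuousMultilinearMap ℂ (fun _ : Fin k => F') ℂ :=
    ContinuousAlternatingMap.toContinuousMultilinearMapCLM ℂ
  have h2 : AnalyticAt ℂ (fun y => (T' (a y)).compContinuousLinearMap fun _ : Fin k => A y) x :=
    AnalyticAt.fun_comp ContinuousMultilinearMap.analyticAt_uncurry_compContinuousLinearMap
      ((AnalyticAt.pi fun _ : Fin k => hA).prod ((T'.analyticAt (a x)).fun_comp ha))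
  refine ((S'.analyticAt _).comp h2).congr (Filter.Eventually.of_forall fun y => ?_)
  exact LinearMap.congr_fun hS ((a y).compContinuousLinearMap (A y))

/-- Functoriality of pull-back applied to `f ∘ φ⁻¹ = ψ⁻¹ ∘ F₁`, where `F₁` is `f` in the charts `φ`,
`ψ`. This holds only near the base point, where `f` stays in the domain of `ψ`. -/
theorem DiffForm.inChart_pullback_eventuallyEq
    (α : DiffForm I' Y k) {f : X → Y} {p : X} (hf : ContMDiffAt I I' ω f p) :
    (DiffForm.pullback (I := I) f α).inChart p =ᶠ[𝓝 (extChartAt I p p)] fun u =>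
      (α.inChart (f p) (writtenInExtChartAt I I' p f u)).compContinuousLinearMap
        (fderiv ℂ (writtenInExtChartAt I I' p f) u) := by
  set F₁ := writtenInExtChartAt I I' p f with hF₁
  have hsymm := continuousAt_extChartAt_symm (I := I) p
  have hfd : ∀ᶠ u in 𝓝 (extChartAt I p p), MDifferentiableAt I I' f ((extChartAt I p).symm u) := by
    have : ∀ᶠ x in 𝓝 ((extChartAt I p).symm (extChartAt I p p)), ContMDiffAt I I' ω f x := by
      rw [extChartAt_to_inv]
      exact (contMDiffAt_iff_contMDiffAt_nhds (by simp)).mp hf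
    exact (hsymm.eventually this).mono fun u hu => hu.mdifferentiableAt (by simp)
  have htgt : ∀ᶠ u in 𝓝 (extChartAt I p p), u ∈ (extChartAt I p).target :=
    extChartAt_target_mem_nhds p
  have hsrc : ∀ᶠ u in 𝓝 (extChartAt I p p),
      f ((extChartAt I p).symm u) ∈ (extChartAt I' (f p)).source := by
    have hc : ContinuousAt (fun u => f ((extChartAt I p).symm u)) (extChartAt I p p) := by
      refine ContinuousAt.comp ?_ hsymm
      rw [extChartAt_to_inv]
      exact hf.continuousAt
    refine hc ?_
    simp only [extChartAt_to_inv]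
    exact extChartAt_source_mem_nhds (f p)
  have hdF : ∀ᶠ u in 𝓝 (extChartAt I p p), DifferentiableAt ℂ F₁ u :=
    ((contDiffAt_writtenInExtChartAt hf).eventually (by simp)).mono
      fun u hu => hu.differentiableAt (by simp)
  filter_upwards [htgt, hsrc.eventually_nhds, hdF, hfd] with u hu hs hd hfu
  have hφ := (contMDiffAt_extChartAt_symm_of_boundaryless hu).mdifferentiableAt
    (by simp : (ω : WithTop ℕ∞) ≠ 0)
  have hmem : F₁ u ∈ (extChartAt I' (f p)).target :=
    (extChartAt I' (f p)).map_source hs.self_of_nhds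
  have hψ := (contMDiffAt_extChartAt_symm_of_boundaryless hmem).mdifferentiableAt
    (by simp : (ω : WithTop ℕ∞) ≠ 0)
  have hcomp : f ∘ (extChartAt I p).symm =ᶠ[𝓝 u] (extChartAt I' (f p)).symm ∘ F₁ :=
    hs.mono fun v hv => ((extChartAt I' (f p)).left_inv hv).symm
  refine (α.pullback_comp_apply hfu hφ).symm.trans ?_
  refine (α.pullback_congr_of_eventuallyEq hcomp).trans ?_
  refine (α.pullback_comp_apply hψ hd.mdifferentiableAt).trans ?_
  unfold DiffForm.pullback
  rw [mfderiv_eq_fderiv]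
  rfl

theorem DiffForm.IsHolomorphic.pullback [FiniteDimensional ℂ F] [CompleteSpace F']
    {α : DiffForm I' Y k} (hα : α.IsHolomorphic) {f : X → Y} (hf : ContMDiff I I' ω f) :
    (DiffForm.pullback (I := I) f α).IsHolomorphic := by
  intro p
  have hF := contDiffAt_writtenInExtChartAt (hf p)
  have hval : writtenInExtChartAt I I' p f (extChartAt I p p) = extChartAt I' (f p) (f p) := by
    simp [writtenInExtChartAt]
  refine AnalyticAt.congr ?_ (α.inChart_pullback_eventuallyEq (hf p)).symm
  refine analyticAt_compContinuousLinearMap ?_ hF.analyticAt.fderiv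
  refine AnalyticAt.comp ?_ hF.analyticAt
  rw [hval]
  exact hα (f p)

/-- In charts this is naturality of `extDeriv` on normed spaces. The map needs to be holomorphic
only at `p`, so that the result also applies to inverse charts. -/
theorem DiffForm.extDer_pullback_apply
    {α : DiffForm I' Y k} (hα : α.IsHolomorphic) {f : X → Y} {p : X}
    (hf : ContMDiffAt I I' ω f p) :
    (DiffForm.pullback (I := I) f α).extDer p = DiffForm.pullback (I := I) f α.extDer p := by
  have hF := contDiffAt_writtenInExtChartAt hf
  have hval : writtenInExtChartAt I I' p f (extChartAt I p p) = extChartAt I' (f p) (f p) := by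
    simp [writtenInExtChartAt]
  have h2 := extDeriv_pullback (r := ω)
    (by rw [hval]; exact (hα (f p)).differentiableAt) hF (by simp)
  rw [DiffForm.extDer_apply, (α.inChart_pullback_eventuallyEq hf).extDeriv_eq, h2]
  unfold DiffForm.pullback
  rw [DiffForm.extDer_apply, mfderiv_eq_fderiv_writtenInExtChartAt (hf.mdifferentiableAt (by simp)),
    hval]
  rfl

theorem DiffForm.extDer_pullback
    {α : DiffForm I' Y k} (hα : α.IsHolomorphic) {f : X → Y} (hf : ContMDiff I I' ω f) :
    (DiffForm.pullback (I := I) f α).extDer = DiffForm.pullback (I := I) f α.extDer :=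
  funext fun p => DiffForm.extDer_pullback_apply hα (hf p)

theorem DiffForm.extDer_normedSpace (α : DiffForm 𝓘(ℂ, F) F k) (u : F) :
    α.extDer u = extDeriv (α : F → F [⋀^Fin k]→L[ℂ] ℂ) u := by
  have h : α.inChart u = (α : F → F [⋀^Fin k]→L[ℂ] ℂ) := by
    funext v
    have : mfderiv 𝓘(ℂ, F) 𝓘(ℂ, F) (extChartAt 𝓘(ℂ, F) u).symm v = ContinuousLinearMap.id ℂ F := by
      rw [extChartAt_model_space_eq_id]
      exact mfderiv_id
    unfold DiffForm.inChart DiffForm.pullback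
    rw [this]
    ext w
    simp
    rfl
  rw [DiffForm.extDer_apply, h]
  rfl

/-- Independence of the chart: `extDer` uses a different chart at each point, and naturality under
the inverse of one fixed chart shows that this chart computes it at all nearby points. -/
theorem DiffForm.IsHolomorphic.inChart_extDer_eventuallyEq
    {α : DiffForm I X k} (hα : α.IsHolomorphic) (p : X) :
    α.extDer.inChart p =ᶠ[𝓝 (extChartAt I p p)] extDeriv (α.inChart p) := by
  have htgt : ∀ᶠ u in 𝓝 (extChartAt I p p), u ∈ (extChartAt I p).target :=
    extChartAt_target_mem_nhds p
  filter_upwards [htgt] with u hu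
  exact (DiffForm.extDer_pullback_apply hα
    (contMDiffAt_extChartAt_symm_of_boundaryless hu)).symm.trans (DiffForm.extDer_normedSpace _ u)

theorem DiffForm.IsHolomorphic.extDer
    {α : DiffForm I X k} (hα : α.IsHolomorphic) : α.extDer.IsHolomorphic := by
  intro p
  refine AnalyticAt.congr ?_ (hα.inChart_extDer_eventuallyEq p).symm
  exact (hα p).extDeriv

theorem DiffForm.IsHolomorphic.extDer_extDer
    {α : DiffForm I X k} (hα : α.IsHolomorphic) : α.extDer.extDer = 0 := by
  funext p
  rw [DiffForm.extDer_apply, (hα.inChart_extDer_eventuallyEq p).extDeriv_eq]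
  exact extDeriv_extDeriv_apply (hα p).contDiffAt (r := ω) (by simp)

end PullbackForms

/-! ### The tautological form in cotangent coordinates -/

section TautologicalForm

variable {E : Type*} [NormedAddCommGroup E] [NormedSpace ℂ E]
  {X : Type*} [TopologicalSpace X] [ChartedSpace E X] [IsManifold 𝓘(ℂ, E) ω X]

/-- In cotangent coordinates `(q, p)` the tautological form is `p dq`. -/
theorem tautologicalForm_inChart_eventuallyEq (α : CotangentBundle E X) :
    (tautologicalForm E X).inChart α =ᶠ[𝓝 (extChartAt (𝓘(ℂ, E).prod 𝓘(ℂ, E →L[ℂ] ℂ)) α α)]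
      fun u => ContinuousAlternatingMap.ofSubsingleton ℂ (E × (E →L[ℂ] ℂ)) ℂ (0 : Fin 1)
        (u.2.comp (ContinuousLinearMap.fst ℂ E (E →L[ℂ] ℂ))) := by
  set J := 𝓘(ℂ, E).prod 𝓘(ℂ, E →L[ℂ] ℂ) with hJ
  have htgt : ∀ᶠ u in 𝓝 (extChartAt J α α), u ∈ (extChartAt J α).target :=
    extChartAt_target_mem_nhds α
  filter_upwards [htgt, htgt.eventually_nhds] with u hu hu'
  set β : CotangentBundle E X := (extChartAt J α).symm u with hβ
  have hchart : ∀ v ∈ (extChartAt J α).target,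
      v.1 ∈ (extChartAt 𝓘(ℂ, E) α.1).target ∧
        ((extChartAt J α).symm v).1 = (extChartAt 𝓘(ℂ, E) α.1).symm v.1 := by
    intro v hv
    have hv' := hv
    rw [hJ, FiberBundle.extChartAt_target] at hv'
    refine ⟨hv'.1.1, ?_⟩
    rw [hJ, FiberBundle.extChartAt]
    exact Bundle.Trivialization.proj_symm_apply'
      (trivializationAt (E →L[ℂ] ℂ)
        (fun x : X => TangentSpace 𝓘(ℂ, E) x →L[ℂ] Bundle.Trivial X ℂ x) α.1) hv'.1.2
  -- The fibre coordinate of a covector is the covector composed with the differential of the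
  -- inverse base chart.
  have hsnd : u.2 = (β.2 : E →L[ℂ] ℂ).comp
      (mfderiv 𝓘(ℂ, E) 𝓘(ℂ, E) (extChartAt 𝓘(ℂ, E) α.1).symm u.1 : E →L[ℂ] E) := by
    obtain ⟨h1, h2⟩ := hchart u hu
    have h3 : extChartAt 𝓘(ℂ, E) α.1 β.1 = u.1 := by
      rw [hβ, h2]
      exact (extChartAt 𝓘(ℂ, E) α.1).right_inv h1
    have h4 : β.1 ∈ (chartAt E α.1).source := by
      rw [← extChartAt_source 𝓘(ℂ, E), hβ, h2]
      exact (extChartAt 𝓘(ℂ, E) α.1).map_target h1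
    have h5 : chartAt (ModelProd E (E →L[ℂ] ℂ)) α β = u := (extChartAt J α).right_inv hu
    have h6 := TangentBundle.symmL_trivializationAt (I := 𝓘(ℂ, E)) h4
    rw [ModelWithCorners.range_eq_univ, mfderivWithin_univ, h3] at h6
    rw [hom_chart] at h5
    rw [← congrArg Prod.snd h5, ← h6]
    ext v
    simp [ContinuousLinearMap.inCoordinates]
    rfl
  -- In coordinates the bundle projection is `Prod.fst`, so `dπ` yields the same differential of the
  -- inverse base chart; together with `hsnd` this gives `p dq`.
  have hproj : mfderiv J 𝓘(ℂ, E) (fun γ : CotangentBundle E X => γ.1) β ∘L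
      mfderiv 𝓘(ℂ, E × (E →L[ℂ] ℂ)) J (extChartAt J α).symm u =
      (mfderiv 𝓘(ℂ, E) 𝓘(ℂ, E) (extChartAt 𝓘(ℂ, E) α.1).symm u.1 : E →L[ℂ] E) ∘L
        ContinuousLinearMap.fst ℂ E (E →L[ℂ] ℂ) := by
    have h1 : MDifferentiableAt J 𝓘(ℂ, E) (fun γ : CotangentBundle E X => γ.1) β :=
      (Bundle.contMDiff_proj (n := ω) _).mdifferentiableAt (by simp)
    have h2 : MDifferentiableAt 𝓘(ℂ, E × (E →L[ℂ] ℂ)) J (extChartAt J α).symm u :=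
      (contMDiffAt_extChartAt_symm_of_boundaryless hu).mdifferentiableAt (n := ω) (by simp)
    have h3 : MDifferentiableAt 𝓘(ℂ, E) 𝓘(ℂ, E) (extChartAt 𝓘(ℂ, E) α.1).symm u.1 :=
      (contMDiffAt_extChartAt_symm_of_boundaryless (hchart u hu).1).mdifferentiableAt
        (n := ω) (by simp)
    have h4 : MDifferentiableAt 𝓘(ℂ, E × (E →L[ℂ] ℂ)) 𝓘(ℂ, E)
        (Prod.fst : E × (E →L[ℂ] ℂ) → E) u := differentiableAt_fst.mdifferentiableAt
    refine (mfderiv_comp u h1 h2).symm.trans ?_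
    have h5 : (fun γ : CotangentBundle E X => γ.1) ∘ (extChartAt J α).symm =ᶠ[𝓝 u]
        (extChartAt 𝓘(ℂ, E) α.1).symm ∘ (Prod.fst : E × (E →L[ℂ] ℂ) → E) :=
      hu'.mono fun v hv => (hchart v hv).2
    refine h5.mfderiv_eq.trans ((mfderiv_comp u h3 h4).trans ?_)
    rw [mfderiv_eq_fderiv, fderiv_fst]
    rfl
  ext v
  rw [hsnd]
  exact congrArg (β.2 : E →L[ℂ] ℂ) (DFunLike.congr_fun hproj (v 0))

theorem tautologicalForm_isHolomorphic : (tautologicalForm E X).IsHolomorphic := by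
  intro α
  refine AnalyticAt.congr ?_ (tautologicalForm_inChart_eventuallyEq α).symm
  let T := ((ContinuousAlternatingMap.ofSubsingletonLIE (𝕜 := ℂ) (E := E × (E →L[ℂ] ℂ)) (F := ℂ)
      (0 : Fin 1)).toContinuousLinearEquiv.toContinuousLinearMap) ∘L
    (ContinuousLinearMap.compL ℂ (E × (E →L[ℂ] ℂ)) E ℂ).flip (ContinuousLinearMap.fst ℂ _ _) ∘L
      ContinuousLinearMap.snd ℂ E (E →L[ℂ] ℂ)
  exact T.analyticAt _

end TautologicalForm

/-! ### Differentials of translations; holomorphy of `Ψ` and `Ad` -/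

section LieGroupDifferentials

variable {E : Type*} [NormedAddCommGroup E] [NormedSpace ℂ E]
  {X : Type*} [TopologicalSpace X] [ChartedSpace E X] [IsManifold 𝓘(ℂ, E) ω X]

/-- Needed for base points such as `g * g⁻¹`, which equal `1` only propositionally. -/
theorem TangentBundle.continuousLinearMapAt_trivializationAt_of_eq {x y z : X} (hy : y = x)
    (hz : z = x) :
    (Bundle.Trivialization.continuousLinearMapAt ℂ
      (trivializationAt E (TangentSpace 𝓘(ℂ, E)) y) z : E →L[ℂ] E) =
      ContinuousLinearMap.id ℂ E := by
  subst hy hz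
  rw [TangentBundle.continuousLinearMapAt_trivializationAt (mem_chart_source E z),
    mfderiv_extChartAt_self]
  rfl

theorem TangentBundle.symmL_trivializationAt_self (x : X) :
    (Bundle.Trivialization.symmL ℂ
      (trivializationAt E (TangentSpace 𝓘(ℂ, E)) x) x : E →L[ℂ] E) =
      ContinuousLinearMap.id ℂ E := by
  rw [TangentBundle.symmL_trivializationAt (mem_chart_source E x),
    mfderivWithin_range_extChartAt_symm]
  rfl

variable {G : Type*} [TopologicalSpace G] [ChartedSpace E G] [Group G]

/-- The differential of `f` at `g`, as an endomorphism of the model space. -/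
def modelDeriv (f : G → G) (g : G) : E →L[ℂ] E :=
  mfderiv 𝓘(ℂ, E) 𝓘(ℂ, E) f g

/-- The differential of `R_a` at `g`, as an endomorphism of the model space. -/
def mulRightDeriv (a g : G) : E →L[ℂ] E :=
  modelDeriv (fun b : G => b * a) g

variable [LieGroup 𝓘(ℂ, E) ω G]

theorem mdifferentiable_mul_right_const (a : G) :
    MDifferentiable 𝓘(ℂ, E) 𝓘(ℂ, E) (fun g : G => g * a) :=
  (contMDiff_mul_right (n := ω)).mdifferentiable (by simp)

theorem mdifferentiable_mul_left_const (a : G) :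
    MDifferentiable 𝓘(ℂ, E) 𝓘(ℂ, E) (fun g : G => a * g) :=
  (contMDiff_mul_left (n := ω)).mdifferentiable (by simp)

theorem mulRightDeriv_comp (a b g : G) :
    mulRightDeriv (E := E) b (g * a) ∘L mulRightDeriv a g = mulRightDeriv (a * b) g := by
  have h := mfderiv_comp (I := 𝓘(ℂ, E)) (I' := 𝓘(ℂ, E)) (I'' := 𝓘(ℂ, E)) g
    (mdifferentiable_mul_right_const (E := E) b (g * a)) (mdifferentiable_mul_right_const a g)
  refine h.symm.trans ?_
  have e : (fun x : G => x * b) ∘ (fun x => x * a) = fun x => x * (a * b) := by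
    funext x
    simp [mul_assoc]
  exact congrArg (fun f : G → G => modelDeriv (E := E) f g) e

omit [LieGroup 𝓘(ℂ, E) ω G] in
theorem mulRightDeriv_one (g : G) :
    mulRightDeriv (E := E) 1 g = ContinuousLinearMap.id ℂ E := by
  have e : (fun x : G => x * 1) = id := by
    funext x
    simp
  refine (congrArg (fun f : G → G => modelDeriv (E := E) f g) e).trans ?_
  exact mfderiv_id

theorem mulRightDeriv_inv_comp (g : G) :
    mulRightDeriv (E := E) g⁻¹ g ∘L mulRightDeriv g 1 = ContinuousLinearMap.id ℂ E := by
  have h := mulRightDeriv_comp (E := E) g g⁻¹ 1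
  rwa [one_mul, mul_inv_cancel, mulRightDeriv_one] at h

theorem mulRightDeriv_comp_inv (g : G) :
    mulRightDeriv (E := E) g 1 ∘L mulRightDeriv g⁻¹ g = ContinuousLinearMap.id ℂ E := by
  have h := mulRightDeriv_comp (E := E) g⁻¹ g g
  rwa [mul_inv_cancel, inv_mul_cancel, mulRightDeriv_one] at h

theorem rightDifferential_inverse (g : G) :
    @Eq (E →L[ℂ] E) (rightDifferential (E := E) g).inverse (mulRightDeriv (E := E) g⁻¹ g) :=
  ContinuousLinearMap.inverse_eq (mulRightDeriv_comp_inv (E := E) g)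
    (mulRightDeriv_inv_comp (E := E) g)

variable [FiniteDimensional ℂ E]

/-- The Killing form, as a continuous bilinear map. -/
def killingCLM : GroupLieAlgebra 𝓘(ℂ, E) G →L[ℂ] E →L[ℂ] ℂ :=
  LinearMap.toContinuousLinearMap
    ((LinearMap.toContinuousLinearMap : (E →ₗ[ℂ] ℂ) ≃ₗ[ℂ] (E →L[ℂ] ℂ)).toLinearMap ∘ₗ
      (killingForm ℂ (GroupLieAlgebra 𝓘(ℂ, E) G) : E →ₗ[ℂ] E →ₗ[ℂ] ℂ))

theorem cotangentTrivialization_snd (q : G × GroupLieAlgebra 𝓘(ℂ, E) G) :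
    (cotangentTrivialization q).2 =
      ((killingCLM (E := E) (G := G) q.2).comp
        (mulRightDeriv (E := E) q.1⁻¹ q.1) : E →L[ℂ] ℂ) :=
  congrArg (fun A : E →L[ℂ] E => (killingCLM (E := E) (G := G) q.2).comp A)
    (rightDifferential_inverse (E := E) q.1)

/-- The inverse of `d_e R_g` is the differential of `R_{g⁻¹}` at `g`, the derivative of a jointly
holomorphic family of maps, so it depends holomorphically on `g`. Its values lie over `g * g⁻¹ = 1`,
where the tangent trivialization is the identity. -/
theorem contMDiff_cotangentTrivialization :
    ContMDiff (𝓘(ℂ, E).prod 𝓘(ℂ, GroupLieAlgebra 𝓘(ℂ, E) G)) (𝓘(ℂ, E).prod 𝓘(ℂ, E →L[ℂ] ℂ)) ω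
      (cotangentTrivialization (E := E) (G := G)) := by
  intro q
  rw [contMDiffAt_hom_bundle]
  refine ⟨contMDiffAt_fst, ?_⟩
  have h1 := ContMDiffAt.mfderiv (I := 𝓘(ℂ, E)) (I' := 𝓘(ℂ, E))
    (J := 𝓘(ℂ, E).prod 𝓘(ℂ, GroupLieAlgebra 𝓘(ℂ, E) G)) (m := ω) (n := ω) (x₀ := q)
    (fun x : G × GroupLieAlgebra 𝓘(ℂ, E) G => fun y : G => y * x.1⁻¹) (fun x => x.1)
    (by
      refine ContMDiff.contMDiffAt ?_
      exact contMDiff_snd.mul (contMDiff_fst.comp contMDiff_fst).inv) contMDiffAt_fst (by simp)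
  have h2 : ContMDiffAt (𝓘(ℂ, E).prod 𝓘(ℂ, GroupLieAlgebra 𝓘(ℂ, E) G)) 𝓘(ℂ, E →L[ℂ] ℂ) ω
      (fun x : G × GroupLieAlgebra 𝓘(ℂ, E) G =>
        killingCLM (E := E) (G := G) x.2) q :=
    (killingCLM (E := E) (G := G)).contMDiff.contMDiffAt.comp q contMDiffAt_snd
  refine (h2.clm_comp h1).congr_of_eventuallyEq (Filter.Eventually.of_forall fun x => ?_)
  have h3 := TangentBundle.continuousLinearMapAt_trivializationAt_of_eq (E := E)
    (mul_inv_cancel q.1) (mul_inv_cancel x.1)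
  have key : ∀ (L : E →L[ℂ] ℂ) (A A' B C : E →L[ℂ] E), A = ContinuousLinearMap.id ℂ E → A' = B →
      (L ∘L A') ∘L C = L ∘L A ∘L B ∘L C := by
    rintro L _ _ B C rfl rfl
    rfl
  refine Eq.trans ?_ (key _ _ _ _ _ h3 (rightDifferential_inverse (E := E) x.1))
  ext v
  exact DFunLike.congr_fun (Bundle.Trivial.continuousLinearMapAt_trivialization ℂ G ℂ x.1) _

/-- `Ad_g` as an endomorphism of the model space. -/
def modelAd (g : G) : E →L[ℂ] E := Ad (E := E) g

omit [FiniteDimensional ℂ E] in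
theorem contMDiff_Ad :
    ContMDiff 𝓘(ℂ, E) 𝓘(ℂ, E →L[ℂ] E) ω (fun g : G => modelAd (E := E) g) := by
  intro q
  have h1 := ContMDiffAt.mfderiv (I := 𝓘(ℂ, E)) (I' := 𝓘(ℂ, E))
    (J := 𝓘(ℂ, E)) (m := ω) (n := ω) (x₀ := q)
    (fun x : G => fun y : G => x * y * x⁻¹) (fun x => 1)
    (by
      refine ContMDiff.contMDiffAt ?_
      exact (contMDiff_fst.mul contMDiff_snd).mul contMDiff_fst.inv) contMDiffAt_const (by simp)
  refine h1.congr_of_eventuallyEq (Filter.Eventually.of_forall fun x => ?_)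
  have h3 := TangentBundle.continuousLinearMapAt_trivializationAt_of_eq (E := E)
    (by simp : q * 1 * q⁻¹ = 1) (by simp : x * 1 * x⁻¹ = 1)
  have h4 := TangentBundle.symmL_trivializationAt_self (E := E) (1 : G)
  unfold inTangentCoordinates ContinuousLinearMap.inCoordinates
  have key : ∀ A B C : E →L[ℂ] E, A = ContinuousLinearMap.id ℂ E →
      C = ContinuousLinearMap.id ℂ E → B = A ∘L B ∘L C := by
    rintro _ B _ rfl rfl
    rfl
  exact key _ _ _ h3 h4

end LieGroupDifferentials

/-! ### `𝔰𝔩₂` algebra: the slice is transverse to adjoint orbits -/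

section SlodowyTransversality

variable {V : Type*} [AddCommGroup V] [Module ℂ V]

/-- The usual `𝔰𝔩₂` commutation formula, using only `[U, B] = H` and `[H, B] = -2B`. With `U = ad x`
for a general point `x` of the slice, `[H, U] = 2U` is not available. -/
theorem mul_pow_succ_of_commutator {U H B : Module.End ℂ V} (hUB : U * B = B * U + H)
    (hHB : H * B = B * H - (2 : ℂ) • B) (n : ℕ) :
    U * B ^ (n + 1) = B ^ (n + 1) * U + ((n : ℂ) + 1) • (B ^ n * H - (n : ℂ) • B ^ n) := by
  induction n with
  | zero => simp [hUB]
  | succ n ih =>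
    have e : B ^ n * H * B = B ^ (n + 1) * H - (2 : ℂ) • B ^ (n + 1) := by
      rw [mul_assoc, hHB, mul_sub, mul_smul_comm, ← mul_assoc, ← pow_succ]
    rw [pow_succ B (n + 1), ← mul_assoc, ih, add_mul, mul_assoc _ U B, hUB, smul_mul_assoc, sub_mul,
      e, smul_mul_assoc, ← pow_succ, mul_add, ← mul_assoc]
    push_cast
    module

theorem pow_mul_of_commutator {H B : Module.End ℂ V}
    (hHB : H * B = B * H - (2 : ℂ) • B) (n : ℕ) :
    H * B ^ n = B ^ n * H - (2 * n : ℂ) • B ^ n := by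
  induction n with
  | zero => simp
  | succ n ih =>
    rw [pow_succ, ← mul_assoc, ih, sub_mul, mul_assoc, hHB, mul_sub, mul_smul_comm, smul_mul_assoc,
      ← mul_assoc]
    push_cast
    module

theorem isNilpotent_of_commutator [FiniteDimensional ℂ V] {H B : Module.End ℂ V}
    (hHB : H * B = B * H - (2 : ℂ) • B) : IsNilpotent B := by
  by_contra hB
  have hne : ∀ n : ℕ, B ^ n ≠ 0 := fun n hn => hB ⟨n, hn⟩
  have hinj : Function.Injective (fun n : ℕ => (-(2 * n) : ℂ)) := fun a b hab => by
    simpa using hab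
  -- Under the commutator with `H`, nonzero powers `B ^ n` would be eigenvectors with distinct
  -- eigenvalues `-2n`: infinitely many independent vectors in a finite-dimensional space.
  let D : Module.End ℂ (Module.End ℂ V) := LinearMap.mulLeft ℂ H - LinearMap.mulRight ℂ H
  have hli := Module.End.eigenvectors_linearIndependent' D (fun n : ℕ => (-(2 * n) : ℂ)) hinj
    (fun n => B ^ n) (fun n => by
      rw [Module.End.hasEigenvector_iff]
      refine ⟨?_, hne n⟩
      rw [Module.End.mem_eigenspace_iff]
      simp [D, pow_mul_of_commutator hHB n])
  exact not_finite_iff_infinite.mpr (inferInstance : Infinite ℕ) hli.finite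

/-- For an `𝔰𝔩₂`-like pair `(U, B)`, the map `B ∘ U` is injective on the range of `B`. -/
theorem apply_eq_zero_of_commutator [FiniteDimensional ℂ V] {U H B : Module.End ℂ V}
    (hUB : U * B = B * U + H) (hHB : H * B = B * H - (2 : ℂ) • B) {y : V}
    (hy : y ∈ LinearMap.range B) (hBU : B (U y) = 0) : y = 0 := by
  classical
  obtain ⟨N, hN⟩ := isNilpotent_of_commutator hHB
  obtain ⟨w, rfl⟩ := hy
  by_contra hne
  have hex : ∃ n, (B ^ n) (B w) = 0 := ⟨N, by simp [hN]⟩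
  have hmin := @Nat.find_min _ _ hex
  have hspec := Nat.find_spec hex
  rcases hn : Nat.find hex with _ | n
  · rw [hn] at hspec; exact hne (by simpa using hspec)
  rw [hn] at hspec
  have hv0 : (B ^ n) (B w) ≠ 0 := hmin (by omega)
  -- `v` is the last nonzero vector of the chain `B w, B (B w), …`, a lowest weight vector.
  set v := (B ^ n) (B w) with hv
  have hBv : B v = 0 := by rw [hv, ← Module.End.mul_apply, ← pow_succ']; exact hspec
  have hBUv : B (U v) = -H v := by
    have := LinearMap.congr_fun hUB v
    simp only [Module.End.mul_apply, LinearMap.add_apply, hBv, map_zero] at this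
    exact eq_neg_of_add_eq_zero_left this.symm
  -- `B (U (B w)) = 0` makes `B w` behave like the top of a string of length `n + 1`, so its bottom
  -- `v` has weight `-n`.
  have hHv : H v = -(n : ℂ) • v := by
    rcases n with _ | n
    · have : v = B w := by simp [hv]
      rw [this, hBU] at hBUv
      rw [this]
      simpa using hBUv.symm
    · have h1 := LinearMap.congr_fun (mul_pow_succ_of_commutator hUB hHB n) (B w)
      have h2 := LinearMap.congr_fun (pow_mul_of_commutator hHB (n + 1)) (B w)
      have h3 := congrArg B h1
      simp only [Module.End.mul_apply, LinearMap.add_apply, LinearMap.sub_apply,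
        LinearMap.smul_apply, map_add, map_sub, map_smul] at h1 h2 h3
      have e1 : ∀ z, B ((B ^ n) z) = (B ^ (n + 1)) z := fun z => by
        rw [pow_succ']; rfl
      have e2 : B ((B ^ (n + 1)) (U (B w))) = 0 := by
        rw [← Module.End.mul_apply, ← pow_succ', pow_succ, Module.End.mul_apply, hBU, map_zero]
      rw [e2, zero_add, e1, e1, ← hv, hBUv] at h3
      rw [← hv] at h2
      have h4 : (B ^ (n + 1)) (H (B w)) = H v + (2 * (n + 1 : ℕ) : ℂ) • v := by
        rw [h2]; module
      rw [h4] at h3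
      have h5 : ((n : ℂ) + 2) • (H v + ((n + 1 : ℕ) : ℂ) • v) = 0 := by
        have : ((n : ℂ) + 2) • (H v + ((n + 1 : ℕ) : ℂ) • v) =
          ((n : ℂ) + 1) • (H v + (2 * (n + 1 : ℕ) : ℂ) • v - (n : ℂ) • v) - -H v := by
          push_cast; module
        rw [this, ← h3, sub_self]
      have h6 : ((n : ℂ) + 2) ≠ 0 := by exact_mod_cast (by omega : n + 2 ≠ 0)
      rw [neg_smul]
      exact eq_neg_of_add_eq_zero_left ((smul_eq_zero.mp h5).resolve_left h6)
  -- A lowest weight vector of weight `-n` ought not to lie in the range of `B ^ (n + 1)`, but `v`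
  -- does. From there it can be lifted to the range of every higher power, which nilpotency forbids.
  have hmem : ∀ j, v ∈ LinearMap.range (B ^ (n + 1 + j)) := by
    intro j
    induction j with
    | zero => exact ⟨w, by rw [hv, add_zero, pow_succ]; rfl⟩
    | succ j ih =>
      obtain ⟨z, hz⟩ := ih
      have h1 := LinearMap.congr_fun (mul_pow_succ_of_commutator hUB hHB (n + 1 + j)) z
      have h2 := LinearMap.congr_fun (pow_mul_of_commutator hHB (n + 1 + j)) z
      have h0 : (B ^ (n + 1 + j + 1)) z = 0 := by rw [pow_succ', Module.End.mul_apply, hz, hBv]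
      simp only [Module.End.mul_apply, LinearMap.add_apply, LinearMap.sub_apply,
        LinearMap.smul_apply, h0, map_zero, hz] at h1 h2
      have h3 : (B ^ (n + 1 + j)) (H z) = H v + (2 * (n + 1 + j : ℕ) : ℂ) • v := by
        rw [h2]; module
      rw [h3, hHv] at h1
      -- With `m = n + 1 + j` and `v = B ^ m z`, the commutation formula reads `0 = B ^ (m + 1) (U
      -- z) + (m + 1) (m - n) v`, and `m - n = j + 1`.
      have hc : ((n + 1 + j : ℕ) + 1 : ℂ) * (j + 1) ≠ 0 := by
        exact_mod_cast (by positivity : (n + 1 + j + 1) * (j + 1) ≠ 0)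
      refine (Submodule.smul_mem_iff _ hc).mp ⟨-U z, ?_⟩
      rw [map_neg, ← add_assoc]
      refine neg_eq_of_add_eq_zero_right (Eq.trans ?_ h1.symm)
      push_cast
      module
  obtain ⟨z, hz⟩ := hmem N
  apply hv0
  rw [← hz, pow_add, Module.End.mul_apply, hN]
  simp

variable {L : Type*} [LieRing L] [LieAlgebra ℂ L] [FiniteDimensional ℂ L]

/-- The orthogonal complement of the centralizer of `x` is the image of `ad x`. -/
theorem mem_range_ad_of_orthogonal [LieAlgebra.IsKilling ℂ L] (x u : L)
    (hu : ∀ z, ⁅x, z⁆ = 0 → killingForm ℂ L z u = 0) :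
    u ∈ LinearMap.range (LieAlgebra.ad ℂ L x) := by
  have hnd := LieAlgebra.IsKilling.killingForm_nondegenerate ℂ L
  have hrefl := (LieModule.traceForm_isSymm ℂ L L).isRefl
  have key := LinearMap.BilinForm.orthogonal_orthogonal hnd hrefl
    (LinearMap.range (LieAlgebra.ad ℂ L x))
  rw [← key, LinearMap.BilinForm.mem_orthogonal_iff]
  intro z hz
  rw [LinearMap.BilinForm.mem_orthogonal_iff] at hz
  -- By the double orthogonal it suffices that `(im ad x)^⊥` centralizes `x`, which is invariance
  -- and nondegeneracy of the Killing form.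
  refine hu z (hnd.1 _ fun w => ?_)
  have h1 := hz ⁅x, w⁆ ⟨w, rfl⟩
  have h2 := LieModule.traceForm_apply_lie_apply ℂ L L w x z
  rw [← lie_skew w x, map_neg, LinearMap.neg_apply] at h2
  rw [LieModule.traceForm_comm, ← h2, neg_eq_zero]
  exact h1

/-- A Slodowy slice is transverse to adjoint orbits. -/
theorem eq_zero_of_slodowy [LieAlgebra.IsKilling ℂ L] {x h η u : L} (hx : ⁅x, η⁆ = h)
    (hη : ⁅h, η⁆ = (-2 : ℂ) • η) (hu : ∀ z, ⁅η, z⁆ = 0 → killingForm ℂ L z u = 0)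
    (hxu : ⁅η, ⁅x, u⁆⁆ = 0) : u = 0 := by
  refine apply_eq_zero_of_commutator (U := LieAlgebra.ad ℂ L x) (H := LieAlgebra.ad ℂ L h)
    (B := LieAlgebra.ad ℂ L η) ?_ ?_ (mem_range_ad_of_orthogonal η u hu) hxu
  · ext z
    simp [← hx]
  · ext z
    have := leibniz_lie h η z
    rw [hη] at this
    simp only [Module.End.mul_apply, LieAlgebra.ad_apply, LinearMap.sub_apply,
      LinearMap.smul_apply, this, smul_lie]
    module

end SlodowyTransversality

/-! ### The Lie bracket from the second derivative of multiplication; `d Ad = ad` -/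

section CoordinateMultiplication

variable {E : Type*} [NormedAddCommGroup E] [NormedSpace ℂ E]
  {G : Type*} [TopologicalSpace G] [ChartedSpace E G] [Group G]

variable (E G) in
/-- The multiplication of `G` in the chart at `1`. -/
def coordMul (u : E × E) : E :=
  extChartAt 𝓘(ℂ, E) (1 : G)
    ((extChartAt 𝓘(ℂ, E) (1 : G)).symm u.1 * (extChartAt 𝓘(ℂ, E) (1 : G)).symm u.2)

variable (E G) in
/-- The coordinates of the identity. -/
def coordOne : E := extChartAt 𝓘(ℂ, E) (1 : G) 1

variable (E G) in
/-- The differential at the identity of a left translation, in the chart at `1`. -/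
def coordLeft (s : E) : E →L[ℂ] E :=
  (fderiv ℂ (coordMul E G) (s, coordOne E G)).comp (ContinuousLinearMap.inr ℂ E E)

variable (E G) in
/-- The differential at the identity of a right translation, in the chart at `1`. -/
def coordRight (s : E) : E →L[ℂ] E :=
  (fderiv ℂ (coordMul E G) (coordOne E G, s)).comp (ContinuousLinearMap.inl ℂ E E)

/-- The point of `G` with given coordinates in the chart at `1`. -/
abbrev ofCoord (s : E) : G := (extChartAt 𝓘(ℂ, E) (1 : G)).symm s

/-- The differential at `g` of the chart at `1`. -/
def chartDeriv (g : G) : E →L[ℂ] E :=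
  mfderiv 𝓘(ℂ, E) 𝓘(ℂ, E) (extChartAt 𝓘(ℂ, E) (1 : G)) g

/-- The differential of `L_a` at `g`, as an endomorphism of the model space. -/
def mulLeftDeriv (a g : G) : E →L[ℂ] E :=
  modelDeriv (fun b : G => a * b) g

theorem ofCoord_coordOne : (ofCoord (coordOne E G) : G) = 1 :=
  extChartAt_to_inv (I := 𝓘(ℂ, E)) (1 : G)

variable [LieGroup 𝓘(ℂ, E) ω G]

theorem contDiffAt_coordMul :
    ContDiffAt ℂ ω (coordMul E G) (coordOne E G, coordOne E G) := by
  rw [← contMDiffAt_iff_contDiffAt]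
  have h1 : ContMDiffAt 𝓘(ℂ, E) 𝓘(ℂ, E) ω (ofCoord : E → G) (coordOne E G) :=
    contMDiffAt_extChartAt_symm_of_boundaryless (mem_extChartAt_target 1)
  have h2 : ContMDiffAt 𝓘(ℂ, E × E) 𝓘(ℂ, E) ω (fun u : E × E => (ofCoord u.1 : G) * ofCoord u.2)
      (coordOne E G, coordOne E G) :=
    ContMDiffAt.mul
      (h1.comp (coordOne E G, coordOne E G) (f := Prod.fst) contDiffAt_fst.contMDiffAt)
      (h1.comp (coordOne E G, coordOne E G) (f := Prod.snd) contDiffAt_snd.contMDiffAt)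
  refine ContMDiffAt.comp (I' := 𝓘(ℂ, E)) _ ?_ h2
  simp only [ofCoord_coordOne, mul_one]
  exact contMDiffAt_extChartAt

theorem contDiffAt_coordLeft : ContDiffAt ℂ ω (coordLeft E G) (coordOne E G) := by
  have h1 := (contDiffAt_coordMul (E := E) (G := G)).fderiv_right (m := ω) (by simp)
  exact (h1.comp (coordOne E G) (f := fun s => (s, coordOne E G))
    (contDiffAt_id.prodMk contDiffAt_const)).clm_comp contDiffAt_const

theorem contDiffAt_coordRight : ContDiffAt ℂ ω (coordRight E G) (coordOne E G) := by
  have h1 := (contDiffAt_coordMul (E := E) (G := G)).fderiv_right (m := ω) (by simp)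
  exact (h1.comp (coordOne E G) (f := fun s => (coordOne E G, s))
    (contDiffAt_const.prodMk contDiffAt_id)).clm_comp contDiffAt_const

/-- Both sides are the mixed second derivative of the multiplication at the identity, so this is
symmetry of second derivatives. -/
theorem fderiv_coordRight_apply (v w : E) :
    fderiv ℂ (coordRight E G) (coordOne E G) v w =
      fderiv ℂ (coordLeft E G) (coordOne E G) w v := by
  have h0 := contDiffAt_coordMul (E := E) (G := G)
  have h1 : DifferentiableAt ℂ (fderiv ℂ (coordMul E G)) (coordOne E G, coordOne E G) :=
    (h0.fderiv_right (m := ω) (by simp)).differentiableAt (by simp)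
  have h2 : HasFDerivAt (fun s : E => (s, coordOne E G)) (ContinuousLinearMap.inl ℂ E E)
      (coordOne E G) := hasFDerivAt_prodMk_left _ _
  have h3 : HasFDerivAt (fun s : E => (coordOne E G, s)) (ContinuousLinearMap.inr ℂ E E)
      (coordOne E G) := hasFDerivAt_prodMk_right _ _
  have hL := (((ContinuousLinearMap.compL ℂ E (E × E) E).flip
    (ContinuousLinearMap.inr ℂ E E)).hasFDerivAt).comp (coordOne E G)
      (HasFDerivAt.comp (f := fun s : E => (s, coordOne E G)) (coordOne E G) h1.hasFDerivAt h2)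
  have hR := (((ContinuousLinearMap.compL ℂ E (E × E) E).flip
    (ContinuousLinearMap.inl ℂ E E)).hasFDerivAt).comp (coordOne E G)
      (HasFDerivAt.comp (f := fun s : E => (coordOne E G, s)) (coordOne E G) h1.hasFDerivAt h3)
  have eL : fderiv ℂ (coordLeft E G) (coordOne E G) = _ := hL.fderiv
  have eR : fderiv ℂ (coordRight E G) (coordOne E G) = _ := hR.fderiv
  rw [eL, eR]
  exact (h0.isSymmSndFDerivAt (by simp)) (0, v) (w, 0)

omit [LieGroup 𝓘(ℂ, E) ω G] in
theorem eventually_ofCoord :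
    ∀ᶠ s in 𝓝 (coordOne E G), s ∈ (extChartAt 𝓘(ℂ, E) (1 : G)).target ∧
      ofCoord s ∈ (extChartAt 𝓘(ℂ, E) (1 : G)).source := by
  have h : ∀ᶠ s in 𝓝 (coordOne E G), s ∈ (extChartAt 𝓘(ℂ, E) (1 : G)).target :=
    extChartAt_target_mem_nhds 1
  exact h.mono fun s hs => ⟨hs, (extChartAt 𝓘(ℂ, E) (1 : G)).map_target hs⟩

theorem mdifferentiableAt_extChartAt_one {g : G}
    (hg : g ∈ (extChartAt 𝓘(ℂ, E) (1 : G)).source) :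
    MDifferentiableAt 𝓘(ℂ, E) 𝓘(ℂ, E) (extChartAt 𝓘(ℂ, E) (1 : G)) g :=
  mdifferentiableAt_extChartAt (by rwa [extChartAt_source] at hg)

theorem coordLeft_eventuallyEq :
    ∀ᶠ s in 𝓝 (coordOne E G),
      coordLeft E G s = chartDeriv (ofCoord s : G) ∘L mulLeftDeriv (ofCoord s : G) 1 := by
  have h0 := (contDiffAt_coordMul (E := E) (G := G)).eventually (by simp)
  have hc : ContinuousAt (fun s : E => (s, coordOne E G)) (coordOne E G) := by fun_prop
  filter_upwards [eventually_ofCoord (E := E) (G := G), hc.eventually h0] with s hs h1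
  have h2 : HasFDerivAt (fun t : E => (s, t)) (ContinuousLinearMap.inr ℂ E E)
      (coordOne E G) := hasFDerivAt_prodMk_right _ _
  have h3 := ((h1.differentiableAt (by simp)).hasFDerivAt.comp (coordOne E G) h2).fderiv
  refine h3.symm.trans ?_
  have hd : MDifferentiableAt 𝓘(ℂ, E) 𝓘(ℂ, E) (extChartAt 𝓘(ℂ, E) (1 : G))
      ((ofCoord s : G) * 1) := by
    rw [mul_one]
    exact mdifferentiableAt_extChartAt_one hs.2
  have hm := mdifferentiable_mul_left_const (E := E) (ofCoord s : G) 1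
  have h4 := mfderiv_eq_fderiv_writtenInExtChartAt (hd.comp (1 : G) hm)
  refine h4.symm.trans ((mfderiv_comp (1 : G) hd hm).trans ?_)
  exact congrArg (fun g : G => chartDeriv (E := E) g ∘L mulLeftDeriv (ofCoord s : G) 1) (mul_one _)

theorem coordRight_eventuallyEq :
    ∀ᶠ s in 𝓝 (coordOne E G),
      coordRight E G s = chartDeriv (ofCoord s : G) ∘L mulRightDeriv (ofCoord s : G) 1 := by
  have h0 := (contDiffAt_coordMul (E := E) (G := G)).eventually (by simp)
  have hc : ContinuousAt (fun s : E => (coordOne E G, s)) (coordOne E G) := by fun_prop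
  filter_upwards [eventually_ofCoord (E := E) (G := G), hc.eventually h0] with s hs h1
  have h2 : HasFDerivAt (fun t : E => (t, s)) (ContinuousLinearMap.inl ℂ E E)
      (coordOne E G) := hasFDerivAt_prodMk_left _ _
  have h3 := ((h1.differentiableAt (by simp)).hasFDerivAt.comp (coordOne E G) h2).fderiv
  refine h3.symm.trans ?_
  have hd : MDifferentiableAt 𝓘(ℂ, E) 𝓘(ℂ, E) (extChartAt 𝓘(ℂ, E) (1 : G))
      (1 * (ofCoord s : G)) := by
    rw [one_mul]
    exact mdifferentiableAt_extChartAt_one hs.2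
  have hm := mdifferentiable_mul_right_const (E := E) (ofCoord s : G) 1
  have h4 := mfderiv_eq_fderiv_writtenInExtChartAt (hd.comp (1 : G) hm)
  refine h4.symm.trans ((mfderiv_comp (1 : G) hd hm).trans ?_)
  exact congrArg (fun g : G => chartDeriv (E := E) g ∘L mulRightDeriv (ofCoord s : G) 1) (one_mul _)

theorem chartDeriv_one : chartDeriv (E := E) (1 : G) = ContinuousLinearMap.id ℂ E :=
  mfderiv_extChartAt_self (I := 𝓘(ℂ, E)) (x := (1 : G))

theorem coordRight_coordOne : coordRight E G (coordOne E G) = ContinuousLinearMap.id ℂ E := by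
  rw [coordRight_eventuallyEq.self_of_nhds, ofCoord_coordOne, chartDeriv_one, mulRightDeriv_one]
  rfl

/-- Differentiates `g a = (g a g⁻¹) g`. -/
theorem mulLeftDeriv_eq (g : G) :
    mulLeftDeriv (E := E) g 1 = mulRightDeriv g 1 ∘L modelAd g := by
  have hconj : MDifferentiableAt 𝓘(ℂ, E) 𝓘(ℂ, E) (fun a : G => g * a * g⁻¹) 1 :=
    (mdifferentiable_mul_right_const (E := E) g⁻¹ _).comp (1 : G)
      (mdifferentiable_mul_left_const (E := E) g 1)
  have h := mfderiv_comp (I := 𝓘(ℂ, E)) (I' := 𝓘(ℂ, E)) (I'' := 𝓘(ℂ, E)) (1 : G)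
    (mdifferentiable_mul_right_const (E := E) g _) hconj
  have e : (fun x : G => x * g) ∘ (fun a => g * a * g⁻¹) = fun a => g * a := by
    funext x
    simp
  have e1 : g * 1 * g⁻¹ = 1 := by simp
  refine (congrArg (fun f : G → G => modelDeriv (E := E) f 1) e).symm.trans (h.trans ?_)
  exact congrArg (fun b : G => mulRightDeriv (E := E) g b ∘L modelAd g) e1

omit [LieGroup 𝓘(ℂ, E) ω G] in
theorem modelAd_one : modelAd (E := E) (1 : G) = ContinuousLinearMap.id ℂ E := by
  have e : (fun a : G => 1 * a * 1⁻¹) = id := by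
    funext x
    simp
  refine (congrArg (fun f : G → G => modelDeriv (E := E) f 1) e).trans ?_
  exact mfderiv_id

theorem coordLeft_coordOne : coordLeft E G (coordOne E G) = ContinuousLinearMap.id ℂ E := by
  rw [coordLeft_eventuallyEq.self_of_nhds, ofCoord_coordOne, chartDeriv_one, mulLeftDeriv_eq,
    mulRightDeriv_one, modelAd_one]
  rfl

variable (E G) in
/-- The Lie bracket, as an operation on the model space. -/
def modelLie (v w : GroupLieAlgebra 𝓘(ℂ, E) G) : E :=
  (⁅v, w⁆ : GroupLieAlgebra 𝓘(ℂ, E) G)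

/-- The bracket of `GroupLieAlgebra` is that of left-invariant fields pulled back to the model
space; this identifies those fields in coordinates. -/
theorem mpullbackWithin_mulInvariantVectorField (v : GroupLieAlgebra 𝓘(ℂ, E) G) :
    (VectorField.mpullbackWithin 𝓘(ℂ, E) 𝓘(ℂ, E) (extChartAt 𝓘(ℂ, E) (1 : G)).symm
      (mulInvariantVectorField v) (Set.range 𝓘(ℂ, E)) : E → E) =ᶠ[𝓝 (coordOne E G)]
      fun s => coordLeft E G s v := by
  filter_upwards [eventually_ofCoord (E := E) (G := G), coordLeft_eventuallyEq (E := E) (G := G)]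
    with s hs hL
  have h1 := ContinuousLinearMap.inverse_eq
    (mfderivWithin_extChartAt_symm_comp_mfderiv_extChartAt (I := 𝓘(ℂ, E)) hs.1)
    (mfderiv_extChartAt_comp_mfderivWithin_extChartAt_symm (I := 𝓘(ℂ, E)) hs.1)
  have h2 := DFunLike.congr_fun h1 (mulInvariantVectorField v (ofCoord s : G))
  exact h2.trans (DFunLike.congr_fun hL v).symm

theorem modelLie_eq_fderiv (v w : E) :
    modelLie E G v w = fderiv ℂ (coordLeft E G) (coordOne E G) v w -
      fderiv ℂ (coordLeft E G) (coordOne E G) w v := by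
  have h1 : ∀ v w : E, fderiv ℂ (fun s => coordLeft E G s w) (coordOne E G) v =
      fderiv ℂ (coordLeft E G) (coordOne E G) v w := by
    intro v w
    have := (contDiffAt_coordLeft (E := E) (G := G)).differentiableAt (by simp)
    rw [fderiv_clm_apply this (differentiableAt_const w)]
    simp
  have h2 : mfderiv 𝓘(ℂ, E) 𝓘(ℂ, E) (extChartAt 𝓘(ℂ, E) (1 : G)) 1 =
      ContinuousLinearMap.id ℂ E := chartDeriv_one
  have h3 : ((extChartAt 𝓘(ℂ, E) (1 : G)).symm ⁻¹' Set.univ ∩ Set.range 𝓘(ℂ, E)) = Set.univ := by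
    simp
  have h4 := Filter.EventuallyEq.lieBracket_vectorField_eq (𝕜 := ℂ)
    (mpullbackWithin_mulInvariantVectorField (E := E) (G := G) v)
    (mpullbackWithin_mulInvariantVectorField (E := E) (G := G) w)
  have h5 : VectorField.lieBracket ℂ (fun s => coordLeft E G s v) (fun s => coordLeft E G s w)
      (coordOne E G) = fderiv ℂ (coordLeft E G) (coordOne E G) v w -
      fderiv ℂ (coordLeft E G) (coordOne E G) w v := by
    rw [VectorField.lieBracket, h1, h1, coordLeft_coordOne]
    rfl
  rw [← h5, ← h4]
  have h6 : ∀ v w : GroupLieAlgebra 𝓘(ℂ, E) G, _ := fun v w =>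
    VectorField.mlieBracketWithin_apply (𝕜 := ℂ) (I := 𝓘(ℂ, E)) (s := Set.univ) (x₀ := (1 : G))
      (V := mulInvariantVectorField v) (W := mulInvariantVectorField w)
  rw [h3] at h6
  refine (h6 v w).trans ?_
  have h7 : (mfderiv 𝓘(ℂ, E) 𝓘(ℂ, E) (extChartAt 𝓘(ℂ, E) (1 : G)) 1).inverse =
      ContinuousLinearMap.id ℂ E :=
    (congrArg ContinuousLinearMap.inverse h2).trans ContinuousLinearMap.inverse_id
  refine (DFunLike.congr_fun h7 _).trans ?_
  exact congrFun (VectorField.lieBracketWithin_univ (𝕜 := ℂ) (E := E)) (coordOne E G)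

/-- Differentiate `coordLeft = coordRight ∘ Ad` at the identity: the derivative of `Ad` is the mixed
second derivative minus its transpose, which is the bracket. -/
theorem fderiv_modelAd_ofCoord [FiniteDimensional ℂ E] (v w : E) :
    fderiv ℂ (fun s : E => modelAd (E := E) (ofCoord s : G)) (coordOne E G) v w =
      modelLie E G v w := by
  have hA : DifferentiableAt ℂ (fun s : E => modelAd (E := E) (ofCoord s : G)) (coordOne E G) := by
    have h1 : ContMDiffAt 𝓘(ℂ, E) 𝓘(ℂ, E) ω (ofCoord : E → G) (coordOne E G) :=
      contMDiffAt_extChartAt_symm_of_boundaryless (mem_extChartAt_target 1)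
    have h2 := (contMDiff_Ad (E := E) (G := G)).contMDiffAt.comp (coordOne E G) h1
    exact (contMDiffAt_iff_contDiffAt.mp h2).differentiableAt (by simp)
  have hR := (contDiffAt_coordRight (E := E) (G := G)).differentiableAt (by simp)
  have hprod : coordLeft E G =ᶠ[𝓝 (coordOne E G)]
      fun s => coordRight E G s ∘L modelAd (E := E) (ofCoord s : G) := by
    filter_upwards [coordLeft_eventuallyEq (E := E) (G := G),
      coordRight_eventuallyEq (E := E) (G := G)] with s h1 h2
    rw [h1, h2, mulLeftDeriv_eq]
    rfl
  have h := congrArg (fun A : E →L[ℂ] E →L[ℂ] E => A v w)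
    (hprod.fderiv_eq.trans (hR.hasFDerivAt.clm_comp hA.hasFDerivAt).fderiv)
  rw [modelLie_eq_fderiv, h, ← fderiv_coordRight_apply v w]
  simp [coordRight_coordOne, ofCoord_coordOne, modelAd_one]

end CoordinateMultiplication

/-! ### Signs of forms -/

section NegForms

variable {F : Type*} [NormedAddCommGroup F] [NormedSpace ℂ F]
  {H : Type*} [TopologicalSpace H] {I : ModelWithCorners ℂ F H}
  {F' : Type*} [NormedAddCommGroup F'] [NormedSpace ℂ F']
  {H' : Type*} [TopologicalSpace H'] {I' : ModelWithCorners ℂ F' H'}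
  {X : Type*} [TopologicalSpace X] [ChartedSpace H X]
  {Y : Type*} [TopologicalSpace Y] [ChartedSpace H' Y]
  {k : ℕ}

theorem DiffForm.pullback_neg (f : X → Y) (α : DiffForm I' Y k) :
    DiffForm.pullback (I := I) f (-α) = -DiffForm.pullback (I := I) f α := rfl

theorem DiffForm.inChart_neg (α : DiffForm I X k) (p : X) : (-α).inChart p = -α.inChart p := rfl

theorem DiffForm.IsHolomorphic.neg {α : DiffForm I X k} (hα : α.IsHolomorphic) :
    (-α).IsHolomorphic := fun p => by
  rw [DiffForm.inChart_neg]
  exact AnalyticAt.neg (hα p)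

theorem DiffForm.extDer_neg (α : DiffForm I X k) : (-α).extDer = -α.extDer := by
  funext p
  have h : extDeriv (-α.inChart p) (extChartAt I p p) =
      -extDeriv (α.inChart p) (extChartAt I p p) := by
    have := extDeriv_smul (x := extChartAt I p p) (-1 : ℂ) (α.inChart p)
    simpa using this
  unfold DiffForm.extDer
  rw [DiffForm.inChart_neg, h]
  rfl

end NegForms

/-! ### The primitive of the form on `G × S` and its invariance -/

section SlodowySymplectic

variable {E : Type*} [NormedAddCommGroup E] [NormedSpace ℂ E] [FiniteDimensional ℂ E]
  {G : Type*} [TopologicalSpace G] [ChartedSpace E G] [Group G] [LieGroup 𝓘(ℂ, E) ω G]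
  (ξ η : GroupLieAlgebra 𝓘(ℂ, E) G)

theorem contMDiff_slodowySlice_coe :
    ContMDiff 𝓘(ℂ, lieCentralizer η) 𝓘(ℂ, GroupLieAlgebra 𝓘(ℂ, E) G) ω
      (fun x : slodowySlice ξ η => (x : GroupLieAlgebra 𝓘(ℂ, E) G)) := by
  intro x
  have h1 : ContMDiffAt 𝓘(ℂ, lieCentralizer η) 𝓘(ℂ, lieCentralizer η) ω
      (extChartAt 𝓘(ℂ, lieCentralizer η) x) x := contMDiffAt_extChartAt
  have h2 : ContDiff ℂ ω (fun z : lieCentralizer η => ξ + (lieCentralizer η).subtypeL z) :=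
    contDiff_const.add (lieCentralizer η).subtypeL.contDiff
  refine (h2.contMDiff.contMDiffAt.comp x h1).congr_of_eventuallyEq
    (Filter.Eventually.of_forall fun y => ?_)
  exact (add_sub_cancel ξ (y : GroupLieAlgebra 𝓘(ℂ, E) G)).symm

/-- The embedding of `G × S(ξ, h, η)` into `T^*G`. -/
def slodowyEmbedding (q : G × slodowySlice ξ η) : CotangentBundle E G :=
  cotangentTrivialization (q.1, (q.2 : GroupLieAlgebra 𝓘(ℂ, E) G))

theorem contMDiff_slodowyInclusion :
    ContMDiff (𝓘(ℂ, E).prod 𝓘(ℂ, lieCentralizer η))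
      (𝓘(ℂ, E).prod 𝓘(ℂ, GroupLieAlgebra 𝓘(ℂ, E) G)) ω
      (fun q : G × slodowySlice ξ η => (q.1, (q.2 : GroupLieAlgebra 𝓘(ℂ, E) G))) :=
  contMDiff_fst.prodMk ((contMDiff_slodowySlice_coe ξ η).comp contMDiff_snd)

theorem contMDiff_slodowyEmbedding :
    ContMDiff (𝓘(ℂ, E).prod 𝓘(ℂ, lieCentralizer η)) (𝓘(ℂ, E).prod 𝓘(ℂ, E →L[ℂ] ℂ)) ω
      (slodowyEmbedding (E := E) ξ η) :=
  contMDiff_cotangentTrivialization.comp (contMDiff_slodowyInclusion ξ η)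

/-- The restriction of the tautological form to `G × S(ξ, h, η)`. -/
def slodowyPrimitive :
    DiffForm (𝓘(ℂ, E).prod 𝓘(ℂ, lieCentralizer η)) (G × slodowySlice ξ η) 1 :=
  DiffForm.pullback (slodowyEmbedding ξ η) (tautologicalForm E G)

theorem slodowyPrimitive_isHolomorphic : (slodowyPrimitive (E := E) ξ η).IsHolomorphic :=
  tautologicalForm_isHolomorphic.pullback (contMDiff_slodowyEmbedding ξ η)

/-- Exactness reduces holomorphy, closedness and invariance to properties of the primitive. -/
theorem slodowyForm_eq : slodowyForm (E := E) ξ η = -(slodowyPrimitive ξ η).extDer := by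
  have h1 := DiffForm.pullback_comp (cotangentForm E G)
    ((contMDiff_cotangentTrivialization (E := E) (G := G)).mdifferentiable (by simp))
    ((contMDiff_slodowyInclusion ξ η).mdifferentiable (by simp))
  refine h1.symm.trans ?_
  rw [slodowyPrimitive, DiffForm.extDer_pullback tautologicalForm_isHolomorphic
    (contMDiff_slodowyEmbedding ξ η)]
  rfl

theorem slodowyPrimitive_apply (q : G × slodowySlice ξ η) (v : Fin 1 → E × lieCentralizer η) :
    (slodowyPrimitive ξ η q : (E × lieCentralizer η) [⋀^Fin 1]→L[ℂ] ℂ) v =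
      killingCLM (E := E) q.2.1 (mulRightDeriv q.1⁻¹ q.1 (v 0).1) := by
  have h1 : MDifferentiableAt (𝓘(ℂ, E).prod 𝓘(ℂ, E →L[ℂ] ℂ)) 𝓘(ℂ, E)
      (fun γ : CotangentBundle E G => γ.1) (slodowyEmbedding ξ η q) :=
    (Bundle.contMDiff_proj (n := ω) _).mdifferentiableAt (by simp)
  have h2 := (contMDiff_slodowyEmbedding ξ η).mdifferentiable (by simp) q
  have h3 := (mfderiv_comp q h1 h2).symm.trans
    (mfderiv_fst (I := 𝓘(ℂ, E)) (I' := 𝓘(ℂ, lieCentralizer η)) (x := q))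
  have h4 := cotangentTrivialization_snd (E := E) (q.1, (q.2 : GroupLieAlgebra 𝓘(ℂ, E) G))
  refine (congrArg (slodowyEmbedding ξ η q).2 (DFunLike.congr_fun h3 (v 0))).trans ?_
  exact DFunLike.congr_fun h4 (v 0).1

theorem mfderiv_slodowyAction (a : G) (q : G × slodowySlice ξ η) (v : E × lieCentralizer η) :
    @Eq (E × lieCentralizer η) (mfderiv (𝓘(ℂ, E).prod 𝓘(ℂ, lieCentralizer η))
      (𝓘(ℂ, E).prod 𝓘(ℂ, lieCentralizer η)) (slodowyAction ξ η a) q v)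
      (mulRightDeriv a⁻¹ q.1 v.1, v.2) := by
  have h1 := mdifferentiable_mul_right_const (E := E) a⁻¹ q.1
  have h2 : MDifferentiableAt (𝓘(ℂ, E).prod 𝓘(ℂ, lieCentralizer η)) 𝓘(ℂ, E)
      (Prod.fst : G × slodowySlice ξ η → G) q := mdifferentiableAt_fst
  have h3 : MDifferentiableAt (𝓘(ℂ, E).prod 𝓘(ℂ, lieCentralizer η)) 𝓘(ℂ, lieCentralizer η)
      (Prod.snd : G × slodowySlice ξ η → slodowySlice ξ η) q := mdifferentiableAt_snd
  have h4 := mfderiv_prodMk (h1.comp q h2) h3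
  rw [mfderiv_comp q h1 h2, mfderiv_fst, mfderiv_snd] at h4
  exact DFunLike.congr_fun h4 v

theorem contMDiff_slodowyAction_uncurry :
    ContMDiff (𝓘(ℂ, E).prod (𝓘(ℂ, E).prod 𝓘(ℂ, lieCentralizer η)))
      (𝓘(ℂ, E).prod 𝓘(ℂ, lieCentralizer η)) ω
      (fun q : G × (G × slodowySlice ξ η) => slodowyAction ξ η q.1 q.2) :=
  ((contMDiff_fst.comp contMDiff_snd).mul contMDiff_fst.inv).prodMk
    (contMDiff_snd.comp contMDiff_snd)

theorem contMDiff_slodowyAction (a : G) :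
    ContMDiff (𝓘(ℂ, E).prod 𝓘(ℂ, lieCentralizer η))
      (𝓘(ℂ, E).prod 𝓘(ℂ, lieCentralizer η)) ω (slodowyAction (E := E) ξ η a) :=
  (contMDiff_slodowyAction_uncurry ξ η).comp (contMDiff_const.prodMk contMDiff_id)

theorem pullback_slodowyAction_slodowyPrimitive (a : G) :
    DiffForm.pullback (slodowyAction ξ η a) (slodowyPrimitive (E := E) ξ η) =
      slodowyPrimitive ξ η := by
  funext q
  refine ContinuousAlternatingMap.ext fun v : Fin 1 → E × lieCentralizer η => ?_
  refine (slodowyPrimitive_apply ξ η (slodowyAction ξ η a q) fun i =>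
    mfderiv (𝓘(ℂ, E).prod 𝓘(ℂ, lieCentralizer η)) (𝓘(ℂ, E).prod 𝓘(ℂ, lieCentralizer η))
      (slodowyAction ξ η a) q (v i)).trans
        (Eq.trans ?_ (slodowyPrimitive_apply ξ η q v).symm)
  rw [mfderiv_slodowyAction]
  -- Moving by `a⁻¹` on the right and then back to the identity by `(g a⁻¹)⁻¹` is the same as
  -- multiplying by `g⁻¹`.
  have h := mulRightDeriv_comp (E := E) a⁻¹ (q.1 * a⁻¹)⁻¹ q.1
  rw [mul_inv_rev, inv_inv, inv_mul_cancel_left] at h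
  rw [← h, ← inv_inv a, ← mul_inv_rev, inv_inv]
  rfl

theorem pullback_slodowyAction_slodowyForm (a : G) :
    DiffForm.pullback (slodowyAction ξ η a) (slodowyForm (E := E) ξ η) = slodowyForm ξ η := by
  rw [slodowyForm_eq, DiffForm.pullback_neg, ← DiffForm.extDer_pullback
    (slodowyPrimitive_isHolomorphic ξ η) (contMDiff_slodowyAction ξ η a),
    pullback_slodowyAction_slodowyPrimitive]

end SlodowySymplectic

/-- Cartan's formula for the exterior derivative of a 1-form. -/
theorem extDeriv_oneForm_apply_vectorField {𝕜 V W : Type*} [NontriviallyNormedField 𝕜]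
    [NormedAddCommGroup V] [NormedSpace 𝕜 V] [NormedAddCommGroup W] [NormedSpace 𝕜 W]
    {α : V → V [⋀^Fin 1]→L[𝕜] W} {A B : V → V} {x : V} (hα : DifferentiableAt 𝕜 α x)
    (hA : DifferentiableAt 𝕜 A x) (hB : DifferentiableAt 𝕜 B x) :
    extDeriv α x ![A x, B x] = fderiv 𝕜 (fun u => α u fun _ => B u) x (A x) -
      fderiv 𝕜 (fun u => α u fun _ => A u) x (B x) -
        α x (fun _ => VectorField.lieBracket 𝕜 A B x) := by
  have h := extDeriv_apply_vectorField (V := ![A, B]) hα (by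
    intro i
    fin_cases i
    exacts [hA, hB])
  have e : ∀ u, (fun i => (![A, B] : Fin 2 → V → V) i u) = ![A u, B u] := fun u => by
    funext i
    fin_cases i <;> rfl
  have e0 : ∀ u, Fin.removeNth (0 : Fin 2) ![A u, B u] = fun _ => B u := fun u => by
    funext i
    fin_cases i
    rfl
  have e1 : ∀ u, Fin.removeNth (1 : Fin 2) ![A u, B u] = fun _ => A u := fun u => by
    funext i
    fin_cases i
    rfl
  have e2 : ∀ (c : V) (t : Fin 0 → V), Matrix.vecCons c t = fun _ => c := fun c t => by
    funext i
    fin_cases i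
    rfl
  simp only [e] at h
  rw [h, Fin.sum_univ_two, Fin.sum_univ_one, e2]
  simp only [e0, e1]
  simp [sub_eq_add_neg]
  exact congrArg _ (e2 _ _)

/-! ### Explicit formula for the form on `G × S` -/

section SlodowyFormula

variable {E : Type*} [NormedAddCommGroup E] [NormedSpace ℂ E] [FiniteDimensional ℂ E]
  {G : Type*} [TopologicalSpace G] [ChartedSpace E G] [Group G] [LieGroup 𝓘(ℂ, E) ω G]
  (ξ η : GroupLieAlgebra 𝓘(ℂ, E) G)

/-- The vector field `(R(s) τ, ζ)` in the product of the chart at `1` and the slice. -/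
def coordRightField (v : E × lieCentralizer η) (u : E × lieCentralizer η) :
    E × lieCentralizer η :=
  (coordRight E G u.1 v.1, v.2)

theorem coordRightField_coordOne (v : E × lieCentralizer η) (z : lieCentralizer η) :
    coordRightField η v (coordOne E G, z) = v := by
  simp [coordRightField, coordRight_coordOne]

theorem hasFDerivAt_coordRightField (v : E × lieCentralizer η) (z : lieCentralizer η) :
    HasFDerivAt (coordRightField (E := E) η v)
      ((((ContinuousLinearMap.apply ℂ E v.1).comp
        (fderiv ℂ (coordRight E G) (coordOne E G))).comp
          (ContinuousLinearMap.fst ℂ E (lieCentralizer η))).prod 0) (coordOne E G, z) := by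
  have hR := ((contDiffAt_coordRight (E := E) (G := G)).differentiableAt (by simp)).hasFDerivAt
  have h1 : HasFDerivAt (fun u : E × lieCentralizer η => coordRight E G u.1) _ (coordOne E G, z) :=
    HasFDerivAt.comp (coordOne E G, z) (f := Prod.fst) hR hasFDerivAt_fst
  exact ((ContinuousLinearMap.apply ℂ E v.1).hasFDerivAt.comp (coordOne E G, z) h1).prodMk
    (hasFDerivAt_const v.2 _)

/-- Right-invariant fields bracket to minus the Lie algebra bracket, hence the exchanged arguments;
the slice components are constant and contribute nothing. -/
theorem lieBracket_coordRightField (v w : E × lieCentralizer η) (z : lieCentralizer η) :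
    VectorField.lieBracket ℂ (coordRightField (E := E) η v) (coordRightField η w)
      (coordOne E G, z) = (modelLie E G w.1 v.1, 0) := by
  rw [VectorField.lieBracket, (hasFDerivAt_coordRightField η v z).fderiv,
    (hasFDerivAt_coordRightField η w z).fderiv, coordRightField_coordOne,
    coordRightField_coordOne, modelLie_eq_fderiv, ← fderiv_coordRight_apply,
    ← fderiv_coordRight_apply]
  simp

/-- The value does not depend on the group coordinate, so in Cartan's formula only slice directions
contribute derivatives. -/
theorem slodowyPrimitive_inChart_coordRightField (x : slodowySlice ξ η)
    (v : E × lieCentralizer η) :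
    ∀ᶠ u in 𝓝 ((coordOne E G, slodowyChart ξ η x) : E × lieCentralizer η),
      (slodowyPrimitive ξ η).inChart (1, x) u (fun _ => coordRightField η v u) =
        killingCLM (E := E) (ξ + (u.2 : GroupLieAlgebra 𝓘(ℂ, E) G)) v.1 := by
  have hc : ContinuousAt (fun u : E × lieCentralizer η => u.1)
    (coordOne E G, slodowyChart ξ η x) := continuousAt_fst
  filter_upwards [hc.eventually (eventually_ofCoord (E := E) (G := G)),
    hc.eventually (coordRight_eventuallyEq (E := E) (G := G))] with u hu hR
  set J := 𝓘(ℂ, E).prod 𝓘(ℂ, lieCentralizer η) with hJ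
  have hsymm : ∀ w : E × lieCentralizer η, ((extChartAt J ((1 : G), x)).symm w).1 = ofCoord w.1 := by
    intro w
    rw [hJ, extChartAt_prod]
    rfl
  have hsymm2 : (((extChartAt J ((1 : G), x)).symm u).2 : GroupLieAlgebra 𝓘(ℂ, E) G) =
      ξ + (u.2 : GroupLieAlgebra 𝓘(ℂ, E) G) := by
    rw [hJ, extChartAt_prod]
    rfl
  have hd : ∀ w : E × lieCentralizer η,
      @Eq E (mfderiv 𝓘(ℂ, E × lieCentralizer η) J (extChartAt J ((1 : G), x)).symm u w).1
        (mfderiv 𝓘(ℂ, E) 𝓘(ℂ, E) (ofCoord : E → G) u.1 w.1) := by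
    intro w
    have htgt : u ∈ (extChartAt J ((1 : G), x)).target := by
      rw [hJ, extChartAt_prod]
      exact ⟨hu.1, by simp [extChartAt, OpenPartialHomeomorph.singletonChartedSpace_chartAt_eq]⟩
    have h2 : MDifferentiableAt 𝓘(ℂ, E × lieCentralizer η) J (extChartAt J ((1 : G), x)).symm u :=
      (contMDiffAt_extChartAt_symm_of_boundaryless htgt).mdifferentiableAt (n := ω) (by simp)
    have h3 : MDifferentiableAt J 𝓘(ℂ, E) (Prod.fst : G × slodowySlice ξ η → G)
      ((extChartAt J ((1 : G), x)).symm u) := mdifferentiableAt_fst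
    have h4 : MDifferentiableAt 𝓘(ℂ, E) 𝓘(ℂ, E) (ofCoord : E → G) u.1 :=
      (contMDiffAt_extChartAt_symm_of_boundaryless hu.1).mdifferentiableAt (n := ω) (by simp)
    have h5 : MDifferentiableAt 𝓘(ℂ, E × lieCentralizer η) 𝓘(ℂ, E)
      (Prod.fst : E × lieCentralizer η → E) u := differentiableAt_fst.mdifferentiableAt
    have h6 : (Prod.fst : G × slodowySlice ξ η → G) ∘ (extChartAt J ((1 : G), x)).symm =
        (ofCoord : E → G) ∘ (Prod.fst : E × lieCentralizer η → E) := funext hsymm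
    have h7 := mfderiv_comp u h3 h2
    rw [mfderiv_fst, h6, mfderiv_comp u h4 h5, mfderiv_eq_fderiv, fderiv_fst] at h7
    exact (DFunLike.congr_fun h7 w).symm
  have h1 : mfderiv 𝓘(ℂ, E) 𝓘(ℂ, E) (ofCoord : E → G) u.1 (coordRight E G u.1 v.1) =
      mulRightDeriv (ofCoord u.1 : G) 1 v.1 := by
    have h := mfderivWithin_extChartAt_symm_comp_mfderiv_extChartAt (I := 𝓘(ℂ, E)) hu.1
    rw [ModelWithCorners.range_eq_univ, mfderivWithin_univ] at h
    rw [hR]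
    exact DFunLike.congr_fun h (mulRightDeriv (ofCoord u.1 : G) 1 v.1)
  refine (slodowyPrimitive_apply ξ η ((extChartAt J ((1 : G), x)).symm u) fun _ =>
    mfderiv 𝓘(ℂ, E × lieCentralizer η) J (extChartAt J ((1 : G), x)).symm u
      (coordRightField η v u)).trans ?_
  rw [hd, hsymm2, hsymm]
  have h2 := DFunLike.congr_fun (mulRightDeriv_inv_comp (E := E) (ofCoord u.1 : G)) v.1
  refine congrArg _ (Eq.trans ?_ h2)
  exact congrArg (mulRightDeriv (ofCoord u.1 : G)⁻¹ (ofCoord u.1 : G)) h1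

theorem slodowyForm_apply_one (x : slodowySlice ξ η) (v w : E × lieCentralizer η) :
    (slodowyForm ξ η ((1 : G), x) : (E × lieCentralizer η) [⋀^Fin 2]→L[ℂ] ℂ) ![v, w] =
      killingCLM (E := E) (w.2 : GroupLieAlgebra 𝓘(ℂ, E) G) v.1 -
        killingCLM (E := E) (v.2 : GroupLieAlgebra 𝓘(ℂ, E) G) w.1 -
          killingCLM (E := E) (x : GroupLieAlgebra 𝓘(ℂ, E) G) (modelLie E G v.1 w.1) := by
  set p₀ : E × lieCentralizer η := (coordOne E G, slodowyChart ξ η x) with hp₀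
  have hω : DifferentiableAt ℂ ((slodowyPrimitive (E := E) ξ η).inChart ((1 : G), x)) p₀ :=
    (slodowyPrimitive_isHolomorphic (E := E) ξ η ((1 : G), x)).differentiableAt
  have key := extDeriv_oneForm_apply_vectorField hω
    (hasFDerivAt_coordRightField (E := E) η v _).differentiableAt
    (hasFDerivAt_coordRightField (E := E) η w _).differentiableAt
  have hfd : ∀ a b : E × lieCentralizer η,
      fderiv ℂ (fun u => (slodowyPrimitive ξ η).inChart ((1 : G), x) u
        (fun _ => coordRightField η a u)) p₀ b =
      killingCLM (E := E) (b.2 : GroupLieAlgebra 𝓘(ℂ, E) G) a.1 := by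
    intro a b
    have h1 : HasFDerivAt (fun u : E × lieCentralizer η =>
        ξ + (lieCentralizer η).subtypeL ((ContinuousLinearMap.snd ℂ E _) u))
        ((lieCentralizer η).subtypeL ∘L ContinuousLinearMap.snd ℂ E _) p₀ :=
      (((lieCentralizer η).subtypeL ∘L ContinuousLinearMap.snd ℂ E _).hasFDerivAt).const_add ξ
    have h2 := ((killingCLM (E := E) (G := G)).flip a.1).hasFDerivAt.comp p₀ h1
    rw [Filter.EventuallyEq.fderiv_eq (slodowyPrimitive_inChart_coordRightField ξ η x a)]
    exact DFunLike.congr_fun h2.fderiv b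
  have hval : ∀ a : E, (slodowyPrimitive ξ η).inChart ((1 : G), x) p₀ (fun _ => (a, 0)) =
      killingCLM (E := E) (x : GroupLieAlgebra 𝓘(ℂ, E) G) a := by
    intro a
    have h := (slodowyPrimitive_inChart_coordRightField ξ η x (a, 0)).self_of_nhds
    rw [coordRightField_coordOne] at h
    refine h.trans ?_
    have hx : ξ + ((slodowyChart ξ η x : lieCentralizer η) : GroupLieAlgebra 𝓘(ℂ, E) G) = x :=
      add_sub_cancel ξ (x : GroupLieAlgebra 𝓘(ℂ, E) G)
    exact congrArg (fun y => killingCLM (E := E) (G := G) y a) hx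
  have hd : (slodowyForm ξ η ((1 : G), x) : (E × lieCentralizer η) [⋀^Fin 2]→L[ℂ] ℂ) =
      -extDeriv ((slodowyPrimitive (E := E) ξ η).inChart ((1 : G), x)) p₀ := by
    rw [slodowyForm_eq]
    exact congrArg Neg.neg (DiffForm.extDer_apply (slodowyPrimitive ξ η) ((1 : G), x))
  rw [hfd, hfd, lieBracket_coordRightField, hval] at key
  simp only [hp₀, coordRightField_coordOne] at key
  refine (DFunLike.congr_fun hd ![v, w]).trans ((congrArg Neg.neg key).trans ?_)
  have hskew : modelLie E G w.1 v.1 = -modelLie E G v.1 w.1 := by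
    rw [modelLie_eq_fderiv, modelLie_eq_fderiv, neg_sub]
  rw [hskew, map_neg]
  ring

/-- The action of `g` carries `(g, x)` to `(1, x)` and preserves the form, so the formula at the
identity is transported. -/
theorem slodowyForm_apply (q : G × slodowySlice ξ η) (v w : E × lieCentralizer η) :
    (slodowyForm ξ η q : (E × lieCentralizer η) [⋀^Fin 2]→L[ℂ] ℂ) ![v, w] =
      killingCLM (E := E) (w.2 : GroupLieAlgebra 𝓘(ℂ, E) G) (mulRightDeriv (E := E) q.1⁻¹ q.1 v.1) -
        killingCLM (E := E) (v.2 : GroupLieAlgebra 𝓘(ℂ, E) G) (mulRightDeriv (E := E) q.1⁻¹ q.1 w.1) -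
          killingCLM (E := E) (q.2 : GroupLieAlgebra 𝓘(ℂ, E) G)
            (modelLie E G (mulRightDeriv (E := E) q.1⁻¹ q.1 v.1) (mulRightDeriv (E := E) q.1⁻¹ q.1 w.1)) := by
  have h1 : ∀ v : E × lieCentralizer η, @Eq (E × lieCentralizer η) _ _ :=
    mfderiv_slodowyAction ξ η q.1 q
  have h2 : ∀ (g : G) (_ : g = 1) (v w : E × lieCentralizer η),
      (slodowyForm ξ η (g, q.2) : (E × lieCentralizer η) [⋀^Fin 2]→L[ℂ] ℂ) ![v, w] =
      killingCLM (E := E) (w.2 : GroupLieAlgebra 𝓘(ℂ, E) G) v.1 -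
        killingCLM (E := E) (v.2 : GroupLieAlgebra 𝓘(ℂ, E) G) w.1 -
          killingCLM (E := E) (q.2 : GroupLieAlgebra 𝓘(ℂ, E) G) (modelLie E G v.1 w.1) := by
    rintro _ rfl v w
    exact slodowyForm_apply_one ξ η q.2 v w
  refine (congrArg (fun α : DiffForm (𝓘(ℂ, E).prod 𝓘(ℂ, lieCentralizer η))
    (G × slodowySlice ξ η) 2 => (α q : (E × lieCentralizer η) [⋀^Fin 2]→L[ℂ] ℂ) ![v, w])
    (pullback_slodowyAction_slodowyForm ξ η q.1)).symm.trans (Eq.trans ?_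
      (h2 (q.1 * q.1⁻¹) (mul_inv_cancel _) (mulRightDeriv (E := E) q.1⁻¹ q.1 v.1, v.2)
        (mulRightDeriv (E := E) q.1⁻¹ q.1 w.1, w.2)))
  refine congrArg (slodowyForm ξ η (q.1 * q.1⁻¹, q.2) :
    (E × lieCentralizer η) [⋀^Fin 2]→L[ℂ] ℂ) ?_
  funext i
  fin_cases i
  exacts [h1 v, h1 w]

end SlodowyFormula

/-! ### Differentials of inversion and of `Ad` -/

section AdjointDifferentials

variable {E : Type*} [NormedAddCommGroup E] [NormedSpace ℂ E]
  {G : Type*} [TopologicalSpace G] [ChartedSpace E G] [Group G] [LieGroup 𝓘(ℂ, E) ω G]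

theorem mdifferentiable_inv :
    MDifferentiable 𝓘(ℂ, E) 𝓘(ℂ, E) (fun g : G => g⁻¹) :=
  (contMDiff_inv 𝓘(ℂ, E) ω).mdifferentiable (by simp)

theorem mdifferentiable_conj (g : G) :
    MDifferentiable 𝓘(ℂ, E) 𝓘(ℂ, E) (fun a : G => g * a * g⁻¹) :=
  (mdifferentiable_mul_right_const g⁻¹).comp (mdifferentiable_mul_left_const g)

/-- Differentiates `g * g⁻¹ = 1` at the identity. -/
theorem modelDeriv_inv_one (v : E) : modelDeriv (fun g : G => g⁻¹) 1 v = -v := by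
  have hmul : MDifferentiableAt (𝓘(ℂ, E).prod 𝓘(ℂ, E)) 𝓘(ℂ, E) (fun p : G × G => p.1 * p.2)
      (1, 1⁻¹) := (contMDiff_mul 𝓘(ℂ, E) ω).mdifferentiable (by simp) _
  have hpair : MDifferentiableAt 𝓘(ℂ, E) (𝓘(ℂ, E).prod 𝓘(ℂ, E)) (fun g : G => (g, g⁻¹)) 1 :=
    mdifferentiableAt_id.prodMk (mdifferentiable_inv 1)
  have h1 := mfderiv_comp (1 : G) hmul hpair
  have e : (fun p : G × G => p.1 * p.2) ∘ (fun g : G => (g, g⁻¹)) = fun _ => 1 := by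
    funext x
    simp
  have h2 : (0 : E) = _ := (DFunLike.congr_fun ((congrArg (fun f : G → G =>
    modelDeriv (E := E) f 1) e).symm.trans h1 |>.symm.trans mfderiv_const) v).symm
  have h3 : ∀ w : E × E, @Eq E _ _ := fun w => mfderiv_prod_eq_add_apply (v := w) hmul
  have h4 : ∀ w : E, @Eq (E × E) _ _ := DFunLike.congr_fun
    (mfderiv_prodMk (mdifferentiableAt_id (I := 𝓘(ℂ, E)) (x := (1 : G)))
      (mdifferentiable_inv (E := E) (1 : G)))
  have h5 : mulLeftDeriv (E := E) (1 : G) 1⁻¹ = ContinuousLinearMap.id ℂ E := by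
    rw [inv_one, mulLeftDeriv_eq, mulRightDeriv_one, modelAd_one]
    rfl
  have h6 : mulRightDeriv (E := E) (1⁻¹ : G) 1 = ContinuousLinearMap.id ℂ E := by
    rw [inv_one, mulRightDeriv_one]
  have h7 : (mfderiv 𝓘(ℂ, E) 𝓘(ℂ, E) (id : G → G) 1 : E →L[ℂ] E) = ContinuousLinearMap.id ℂ E :=
    mfderiv_id
  have h8 : (0 : E) = mulRightDeriv (E := E) (1⁻¹ : G) 1
      ((mfderiv 𝓘(ℂ, E) 𝓘(ℂ, E) (id : G → G) 1 : E →L[ℂ] E) v) +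
      mulLeftDeriv (E := E) (1 : G) 1⁻¹ (modelDeriv (fun g : G => g⁻¹) 1 v) := by
    refine h2.trans ((congrArg (mfderiv (𝓘(ℂ, E).prod 𝓘(ℂ, E)) 𝓘(ℂ, E)
      (fun p : G × G => p.1 * p.2) (1, 1⁻¹)) (h4 v)).trans (h3 _))
  rw [h5, h6, h7] at h8
  exact (neg_eq_of_add_eq_zero_right h8.symm).symm

/-- Differentiates `g a⁻¹ g⁻¹ = (g a g⁻¹)⁻¹`; this is the right-trivialized fundamental vector
field. -/
theorem mulRightDeriv_mfderiv_mul_inv (g : G) (y : E) :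
    mulRightDeriv (E := E) g⁻¹ g (modelDeriv (fun a : G => g * a⁻¹) 1 y) = -modelAd g y := by
  have hd : MDifferentiableAt 𝓘(ℂ, E) 𝓘(ℂ, E) (fun a : G => g * a⁻¹) 1 :=
    (mdifferentiable_mul_left_const g _).comp (1 : G) (mdifferentiable_inv 1)
  have h1 := mfderiv_comp (1 : G) (mdifferentiable_mul_right_const (E := E) g⁻¹ (g * 1⁻¹)) hd
  have h2 := mfderiv_comp (1 : G) (mdifferentiable_inv (E := E) (g * 1 * g⁻¹))
    (mdifferentiable_conj (E := E) g 1)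
  have e : (fun x : G => x * g⁻¹) ∘ (fun a => g * a⁻¹) = (fun a => a⁻¹) ∘ fun a => g * a * g⁻¹ := by
    funext x
    simp [mul_assoc]
  have h3 : mulRightDeriv (E := E) g⁻¹ (g * 1⁻¹) ∘L modelDeriv (fun a : G => g * a⁻¹) 1 =
      modelDeriv (fun a : G => a⁻¹) (g * 1 * g⁻¹) ∘L modelAd g :=
    h1.symm.trans ((congrArg (fun f : G → G => modelDeriv (E := E) f 1) e).trans h2)
  rw [inv_one, mul_one, mul_inv_cancel] at h3
  exact (DFunLike.congr_fun h3 y).trans (modelDeriv_inv_one _)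

theorem modelAd_mul (g k : G) :
    modelAd (E := E) (g * k) = modelAd g ∘L modelAd k := by
  have h := mfderiv_comp (1 : G) (mdifferentiable_conj (E := E) g (k * 1 * k⁻¹))
    (mdifferentiable_conj (E := E) k 1)
  have e : (fun x : G => g * x * g⁻¹) ∘ (fun a => k * a * k⁻¹) =
      fun a => g * k * a * (g * k)⁻¹ := by
    funext x
    simp [mul_assoc]
  have h3 : modelAd (E := E) (g * k) =
      modelDeriv (fun a : G => g * a * g⁻¹) (k * 1 * k⁻¹) ∘L modelAd k :=
    (congrArg (fun f : G → G => modelDeriv (E := E) f 1) e).symm.trans h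
  rw [h3, mul_one, mul_inv_cancel]
  rfl

theorem contMDiff_clm_modelAd (L : E →L[ℂ] ℂ) (y : E) :
    ContMDiff 𝓘(ℂ, E) 𝓘(ℂ, ℂ) ω (fun z : G => L (modelAd (E := E) z y)) :=
  (L ∘L ContinuousLinearMap.apply ℂ E y).contMDiff.comp contMDiff_Ad

variable [FiniteDimensional ℂ E]

theorem mfderiv_clm_modelAd (L : E →L[ℂ] ℂ) (g : G) (y u : E) :
    @Eq ℂ (mfderiv 𝓘(ℂ, E) 𝓘(ℂ, ℂ) (fun z : G => L (modelAd (E := E) z y)) g u)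
      (L (modelLie E G (mulRightDeriv (E := E) g⁻¹ g u) (modelAd (E := E) g y))) := by
  have h1 : ∀ y u : E, @Eq ℂ
      (mfderiv 𝓘(ℂ, E) 𝓘(ℂ, ℂ) (fun z : G => L (modelAd (E := E) z y)) (1 : G) u)
        (L (modelLie E G u y)) := by
    intro y u
    have hd := (contMDiff_clm_modelAd (G := G) L y).mdifferentiable (by simp) 1
    have h2 := mfderiv_eq_fderiv_writtenInExtChartAt hd
    have hA : DifferentiableAt ℂ (fun s : E => modelAd (E := E) (ofCoord s : G))
        (coordOne E G) := by
      have h1 : ContMDiffAt 𝓘(ℂ, E) 𝓘(ℂ, E) ω (ofCoord : E → G) (coordOne E G) :=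
        contMDiffAt_extChartAt_symm_of_boundaryless (mem_extChartAt_target 1)
      have h2 := (contMDiff_Ad (E := E) (G := G)).contMDiffAt.comp (coordOne E G) h1
      exact (contMDiffAt_iff_contDiffAt.mp h2).differentiableAt (by simp)
    have h3 := ((L ∘L ContinuousLinearMap.apply ℂ E y).hasFDerivAt.comp (coordOne E G)
      hA.hasFDerivAt).fderiv
    refine (DFunLike.congr_fun (h2.trans h3) u).trans ?_
    exact congrArg L (fderiv_modelAd_ofCoord u y)
  -- `Ad_z = Ad_{z g⁻¹} Ad_g` moves the computation from `g` to the identity.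
  have e : (fun z : G => L (modelAd (E := E) z y)) =
      (fun z : G => L (modelAd (E := E) z (modelAd (E := E) g y))) ∘ fun z => z * g⁻¹ := by
    funext z
    have := modelAd_mul (E := E) (z * g⁻¹) g
    rw [inv_mul_cancel_right] at this
    rw [this]
    rfl
  have h2 := mfderiv_comp g
    ((contMDiff_clm_modelAd (G := G) L (modelAd (E := E) g y)).mdifferentiable (by simp) _)
    (mdifferentiable_mul_right_const (E := E) g⁻¹ g)
  have h3 : ∀ k : G, k = 1 → ∀ y u : E, @Eq ℂ
      (mfderiv 𝓘(ℂ, E) 𝓘(ℂ, ℂ) (fun z : G => L (modelAd (E := E) z y)) k u)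
        (L (modelLie E G u y)) := by
    rintro _ rfl
    exact h1
  rw [e]
  exact (DFunLike.congr_fun h2 u).trans (h3 _ (mul_inv_cancel g) _ _)

end AdjointDifferentials

/-! ### Moment map, nondegeneracy and the conclusion -/

section SlodowyHamiltonian

variable {E : Type*} [NormedAddCommGroup E] [NormedSpace ℂ E] [FiniteDimensional ℂ E]
  {G : Type*} [TopologicalSpace G] [ChartedSpace E G] [Group G] [LieGroup 𝓘(ℂ, E) ω G]
  (ξ η : GroupLieAlgebra 𝓘(ℂ, E) G)

theorem mfderiv_slodowySlice_coe (x : slodowySlice ξ η) (v : lieCentralizer η) :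
    @Eq E (mfderiv 𝓘(ℂ, lieCentralizer η) 𝓘(ℂ, GroupLieAlgebra 𝓘(ℂ, E) G)
      (fun x : slodowySlice ξ η => (x : GroupLieAlgebra 𝓘(ℂ, E) G)) x v)
      (v : GroupLieAlgebra 𝓘(ℂ, E) G) := by
  have h1 : MDifferentiableAt 𝓘(ℂ, lieCentralizer η) 𝓘(ℂ, lieCentralizer η)
      (extChartAt 𝓘(ℂ, lieCentralizer η) x) x :=
    (contMDiffAt_extChartAt (n := ω)).mdifferentiableAt (by simp)
  have h2 : ∀ z, HasFDerivAt (fun z : lieCentralizer η => ξ + (lieCentralizer η).subtypeL z)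
      (lieCentralizer η).subtypeL z := fun z => (lieCentralizer η).subtypeL.hasFDerivAt.const_add ξ
  have e : (fun x : slodowySlice ξ η => (x : GroupLieAlgebra 𝓘(ℂ, E) G)) =
      (fun z : lieCentralizer η => ξ + (lieCentralizer η).subtypeL z) ∘
        extChartAt 𝓘(ℂ, lieCentralizer η) x :=
    funext fun y => (add_sub_cancel ξ (y : GroupLieAlgebra 𝓘(ℂ, E) G)).symm
  have h3 := mfderiv_comp x (h2 _).differentiableAt.mdifferentiableAt h1
  have h4 := mfderiv_eq_fderiv.trans (h2 (extChartAt 𝓘(ℂ, lieCentralizer η) x x)).fderiv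
  have h5 := mfderiv_extChartAt_self (I := 𝓘(ℂ, lieCentralizer η)) (x := x)
  rw [e]
  refine (DFunLike.congr_fun h3 v).trans ((DFunLike.congr_fun h4 _).trans ?_)
  exact congrArg (lieCentralizer η).subtypeL (DFunLike.congr_fun h5 v)

theorem slodowyMomentMap_apply (q : G × slodowySlice ξ η) (y : GroupLieAlgebra 𝓘(ℂ, E) G) :
    slodowyMomentMap ξ η q y =
      -killingCLM (E := E) (q.2 : GroupLieAlgebra 𝓘(ℂ, E) G) (modelAd (E := E) q.1 y) := by
  have h : ∀ g : G, g = q.1 → ((-killingDual (q.2 : GroupLieAlgebra 𝓘(ℂ, E) G) (Ad g y)) : ℂ) =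
      -killingCLM (E := E) (q.2 : GroupLieAlgebra 𝓘(ℂ, E) G) (modelAd (E := E) q.1 y) := by
    rintro _ rfl
    rfl
  exact h _ (inv_inv q.1)

theorem contMDiff_killingCLM_slodowySlice_modelAd (y : E) :
    ContMDiff (𝓘(ℂ, E).prod 𝓘(ℂ, lieCentralizer η)) 𝓘(ℂ, ℂ) ω
      (fun q : G × slodowySlice ξ η =>
        killingCLM (E := E) (q.2 : GroupLieAlgebra 𝓘(ℂ, E) G) (modelAd (E := E) q.1 y)) := by
  have h1 : ContMDiff (𝓘(ℂ, E).prod 𝓘(ℂ, lieCentralizer η)) 𝓘(ℂ, E →L[ℂ] ℂ) ω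
      (fun q : G × slodowySlice ξ η =>
        killingCLM (E := E) (G := G) (q.2 : GroupLieAlgebra 𝓘(ℂ, E) G)) :=
    (killingCLM (E := E) (G := G)).contMDiff.comp
      ((contMDiff_slodowySlice_coe ξ η).comp contMDiff_snd)
  have h2 : ContMDiff (𝓘(ℂ, E).prod 𝓘(ℂ, lieCentralizer η)) 𝓘(ℂ, E) ω
      (fun q : G × slodowySlice ξ η => modelAd (E := E) q.1 y) :=
    ((ContinuousLinearMap.apply ℂ E y).contMDiff.comp contMDiff_Ad).comp contMDiff_fst
  exact h1.clm_apply h2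

theorem contMDiff_slodowyMomentMap (y : GroupLieAlgebra 𝓘(ℂ, E) G) :
    ContMDiff (𝓘(ℂ, E).prod 𝓘(ℂ, lieCentralizer η)) 𝓘(ℂ, ℂ) ω
      (fun q => slodowyMomentMap ξ η q y) := by
  have h := (-ContinuousLinearMap.id ℂ ℂ).contMDiff.comp
    (contMDiff_killingCLM_slodowySlice_modelAd (E := E) (G := G) ξ η y) (n := ω)
  exact h.congr fun q => slodowyMomentMap_apply ξ η q y

theorem slodowyMomentMap_slodowyAction (g : G) (q : G × slodowySlice ξ η) :
    slodowyMomentMap ξ η (slodowyAction ξ η g q) = coAd g (slodowyMomentMap ξ η q) := by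
  refine LinearMap.ext fun y => ?_
  refine (slodowyMomentMap_apply ξ η (slodowyAction ξ η g q) y).trans
    (Eq.trans ?_ (slodowyMomentMap_apply ξ η q (Ad g⁻¹ y)).symm)
  exact congrArg (fun z => -killingCLM (E := E) (q.2 : GroupLieAlgebra 𝓘(ℂ, E) G) z)
    (DFunLike.congr_fun (modelAd_mul (E := E) q.1 g⁻¹) y)

theorem mfderiv_slodowyMomentMap (y : GroupLieAlgebra 𝓘(ℂ, E) G) (q : G × slodowySlice ξ η)
    (v : E × lieCentralizer η) :
    @Eq ℂ (mfderiv (𝓘(ℂ, E).prod 𝓘(ℂ, lieCentralizer η)) 𝓘(ℂ, ℂ)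
      (fun q => slodowyMomentMap ξ η q y) q v)
      (-killingCLM (E := E) (q.2 : GroupLieAlgebra 𝓘(ℂ, E) G)
        (modelLie E G (mulRightDeriv (E := E) q.1⁻¹ q.1 v.1) (modelAd (E := E) q.1 y)) -
        killingCLM (E := E) (v.2 : GroupLieAlgebra 𝓘(ℂ, E) G) (modelAd (E := E) q.1 y)) := by
  have h1 := mfderiv_prod_eq_add_apply (v := v)
    ((contMDiff_slodowyMomentMap ξ η y).mdifferentiable (by simp) q)
  have h2 : @Eq ℂ (mfderiv 𝓘(ℂ, E) 𝓘(ℂ, ℂ) (fun z => slodowyMomentMap ξ η (z, q.2) y) q.1 v.1)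
      (-killingCLM (E := E) (q.2 : GroupLieAlgebra 𝓘(ℂ, E) G)
        (modelLie E G (mulRightDeriv (E := E) q.1⁻¹ q.1 v.1) (modelAd (E := E) q.1 y))) := by
    have e : (fun z => slodowyMomentMap ξ η (z, q.2) y) = fun z : G =>
        (-killingCLM (E := E) (q.2 : GroupLieAlgebra 𝓘(ℂ, E) G)) (modelAd (E := E) z y) :=
      funext fun z => slodowyMomentMap_apply ξ η (z, q.2) y
    rw [e]
    exact mfderiv_clm_modelAd (E := E)
      (-killingCLM (E := E) (q.2 : GroupLieAlgebra 𝓘(ℂ, E) G)) q.1 y v.1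
  have h3 : @Eq ℂ (mfderiv 𝓘(ℂ, lieCentralizer η) 𝓘(ℂ, ℂ)
      (fun z => slodowyMomentMap ξ η (q.1, z) y) q.2 v.2)
      (-killingCLM (E := E) (v.2 : GroupLieAlgebra 𝓘(ℂ, E) G) (modelAd (E := E) q.1 y)) := by
    let L : GroupLieAlgebra 𝓘(ℂ, E) G →L[ℂ] ℂ :=
      -(killingCLM (E := E) (G := G)).flip (modelAd (E := E) q.1 y)
    have e : (fun z => slodowyMomentMap ξ η (q.1, z) y) =
        L ∘ fun z : slodowySlice ξ η => (z : GroupLieAlgebra 𝓘(ℂ, E) G) :=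
      funext fun z => slodowyMomentMap_apply ξ η (q.1, z) y
    have h4 := mfderiv_comp q.2 L.differentiableAt.mdifferentiableAt
      ((contMDiff_slodowySlice_coe (E := E) ξ η).mdifferentiable (by simp) q.2)
    have h5 := mfderiv_eq_fderiv.trans (L.fderiv (x := (q.2 : GroupLieAlgebra 𝓘(ℂ, E) G)))
    rw [e]
    refine (DFunLike.congr_fun h4 v.2).trans ((DFunLike.congr_fun h5 _).trans ?_)
    exact congrArg L (mfderiv_slodowySlice_coe ξ η q.2 v.2)
  exact h1.trans (congrArg₂ (fun a b : ℂ => a + b) h2 h3)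

theorem fundamentalVectorField_slodowyAction (y : GroupLieAlgebra 𝓘(ℂ, E) G)
    (q : G × slodowySlice ξ η) :
    @Eq (E × lieCentralizer η) (fundamentalVectorField (𝓘(ℂ, E).prod 𝓘(ℂ, lieCentralizer η))
      (slodowyAction ξ η) y q) (modelDeriv (fun a : G => q.1 * a⁻¹) 1 y, 0) := by
  have hd : MDifferentiableAt 𝓘(ℂ, E) 𝓘(ℂ, E) (fun a : G => q.1 * a⁻¹) 1 :=
    (mdifferentiable_mul_left_const q.1 _).comp (1 : G) (mdifferentiable_inv 1)
  have hc : MDifferentiableAt 𝓘(ℂ, E) 𝓘(ℂ, lieCentralizer η) (fun _ : G => q.2) 1 :=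
    mdifferentiableAt_const
  have h := mfderiv_prodMk hd hc
  rw [mfderiv_const] at h
  exact DFunLike.congr_fun h y

/-- Restates the formula with the Killing form and bracket of the Lie algebra itself, for any
expressions `u`, `u'` of the trivialized components. -/
theorem slodowyForm_apply_of_eq (q : G × slodowySlice ξ η) {v w : E × lieCentralizer η}
    {u u' : GroupLieAlgebra 𝓘(ℂ, E) G} (hu : @Eq E (mulRightDeriv (E := E) q.1⁻¹ q.1 v.1) u)
    (hu' : @Eq E (mulRightDeriv (E := E) q.1⁻¹ q.1 w.1) u') :
    (slodowyForm ξ η q : (E × lieCentralizer η) [⋀^Fin 2]→L[ℂ] ℂ) ![v, w] =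
      killingForm ℂ (GroupLieAlgebra 𝓘(ℂ, E) G) w.2 u -
        killingForm ℂ (GroupLieAlgebra 𝓘(ℂ, E) G) v.2 u' -
          killingForm ℂ (GroupLieAlgebra 𝓘(ℂ, E) G) q.2 ⁅u, u'⁆ := by
  subst hu hu'
  exact slodowyForm_apply ξ η q v w

theorem isMomentMap_slodowyMomentMap :
    IsMomentMap (slodowyForm ξ η) (slodowyAction ξ η) (slodowyMomentMap ξ η) where
  holomorphic := contMDiff_slodowyMomentMap ξ η
  equivariant := slodowyMomentMap_slodowyAction ξ η
  differential y q (v : E × lieCentralizer η) := by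
    let u : GroupLieAlgebra 𝓘(ℂ, E) G := mulRightDeriv (E := E) q.1⁻¹ q.1 v.1
    let y' : GroupLieAlgebra 𝓘(ℂ, E) G := modelAd (E := E) q.1 y
    have h1 : @Eq ℂ (mfderiv (𝓘(ℂ, E).prod 𝓘(ℂ, lieCentralizer η)) 𝓘(ℂ, ℂ)
        (fun q => slodowyMomentMap ξ η q y) q v)
        (-killingForm ℂ (GroupLieAlgebra 𝓘(ℂ, E) G) q.2 ⁅u, y'⁆ -
          killingForm ℂ (GroupLieAlgebra 𝓘(ℂ, E) G) v.2 y') := mfderiv_slodowyMomentMap ξ η y q v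
    have h2 := slodowyForm_apply_of_eq ξ η q
      (v := (modelDeriv (fun a : G => q.1 * a⁻¹) 1 y, 0)) (w := v) (u := -y') (u' := u)
      (mulRightDeriv_mfderiv_mul_inv (E := E) q.1 y) rfl
    refine h1.trans (Eq.trans ?_ (h2.symm.trans (congrArg (fun z : E × lieCentralizer η =>
      (slodowyForm ξ η q : (E × lieCentralizer η) [⋀^Fin 2]→L[ℂ] ℂ) ![z, v])
      (fundamentalVectorField_slodowyAction ξ η y q).symm)))
    simp only [map_neg, Submodule.coe_zero, map_zero, LinearMap.zero_apply, neg_lie, lie_skew]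
    ring

theorem slodowyForm_nondegenerate
    [LieAlgebra.IsKilling ℂ (GroupLieAlgebra 𝓘(ℂ, E) G)] {ξ h η : GroupLieAlgebra 𝓘(ℂ, E) G}
    (hT : IsSl2TripleRel ξ h η) (q : G × slodowySlice ξ η) (v : E × lieCentralizer η)
    (hv : ∀ w : E × lieCentralizer η,
      (slodowyForm ξ η q : (E × lieCentralizer η) [⋀^Fin 2]→L[ℂ] ℂ) ![v, w] = 0) : v = 0 := by
  let x : GroupLieAlgebra 𝓘(ℂ, E) G := q.2
  let u : GroupLieAlgebra 𝓘(ℂ, E) G := mulRightDeriv (E := E) q.1⁻¹ q.1 v.1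
  have hinv : ∀ z : E, mulRightDeriv (E := E) q.1⁻¹ q.1 (mulRightDeriv (E := E) q.1 1 z) = z :=
    DFunLike.congr_fun (mulRightDeriv_inv_comp (E := E) q.1)
  -- Testing against slice directions puts `u` in the orthogonal complement of `Z(η)`.
  have h1 : ∀ z, ⁅η, z⁆ = 0 → killingForm ℂ (GroupLieAlgebra 𝓘(ℂ, E) G) z u = 0 := by
    intro z hz
    have h := (slodowyForm_apply_of_eq ξ η q (v := v) (w := (0, ⟨z, hz⟩)) (u := u) (u' := 0) rfl
      (map_zero _)).symm.trans (hv _)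
    simpa using h
  -- Testing against group directions and moving `x` across by invariance of the Killing form.
  have h2 : ∀ z, killingForm ℂ (GroupLieAlgebra 𝓘(ℂ, E) G)
      ((v.2 : GroupLieAlgebra 𝓘(ℂ, E) G) + ⁅x, u⁆) z = 0 := by
    intro z
    have h := (slodowyForm_apply_of_eq ξ η q (v := v) (w := (mulRightDeriv (E := E) q.1 1 z, 0))
      (u := u) (u' := z) rfl (hinv z)).symm.trans (hv _)
    rw [map_add, LinearMap.add_apply, killingForm, LieModule.traceForm_apply_lie_apply]
    simp only [Submodule.coe_zero, map_zero, LinearMap.zero_apply, zero_sub] at h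
    rw [← neg_eq_zero, neg_add']
    exact h
  have h3 : (v.2 : GroupLieAlgebra 𝓘(ℂ, E) G) + ⁅x, u⁆ = 0 :=
    (LieAlgebra.IsKilling.killingForm_nondegenerate ℂ (GroupLieAlgebra 𝓘(ℂ, E) G)).1 _ h2
  have hv2 : ⁅η, (v.2 : GroupLieAlgebra 𝓘(ℂ, E) G)⁆ = 0 := v.2.2
  -- The relation `[ξ, η] = h` persists along the slice because `x - ξ` commutes with `η`.
  have hx : ⁅x, η⁆ = h := by
    obtain ⟨z, hz, hxz⟩ := q.2.2
    have hz' : ⁅z, η⁆ = 0 := by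
      rw [← lie_skew, neg_eq_zero]
      exact hz
    have : x = ξ + z := hxz
    rw [this, add_lie, hT.lie_xi_eta, hz', add_zero]
  have hu : u = 0 := by
    refine eq_zero_of_slodowy hx hT.lie_h_eta h1 ?_
    rw [← neg_eq_of_add_eq_zero_right h3, lie_neg, hv2, neg_zero]
  refine Prod.ext ?_ ?_
  · have h4 := DFunLike.congr_fun (mulRightDeriv_comp_inv (E := E) q.1) v.1
    exact h4.symm.trans ((congrArg (mulRightDeriv (E := E) q.1 1) hu).trans (map_zero _))
  · rw [hu, lie_zero, add_zero] at h3
    exact Subtype.ext h3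

theorem isHolomorphicSymplectic_slodowyForm
    [LieAlgebra.IsKilling ℂ (GroupLieAlgebra 𝓘(ℂ, E) G)] {ξ h η : GroupLieAlgebra 𝓘(ℂ, E) G}
    (hT : IsSl2TripleRel ξ h η) : IsHolomorphicSymplectic (slodowyForm ξ η) where
  holomorphic := by
    rw [slodowyForm_eq]
    exact (slodowyPrimitive_isHolomorphic ξ η).extDer.neg
  closed := by
    rw [slodowyForm_eq, DiffForm.extDer_neg,
      (slodowyPrimitive_isHolomorphic ξ η).extDer_extDer, neg_zero]
  nondegenerate := slodowyForm_nondegenerate hT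

theorem isHolomorphicAction_slodowyAction :
    IsHolomorphicAction E (𝓘(ℂ, E).prod 𝓘(ℂ, lieCentralizer η)) (slodowyAction (G := G) ξ η) where
  one_act q := by simp [slodowyAction]
  mul_act g k q := by simp [slodowyAction, mul_assoc]
  holomorphic := contMDiff_slodowyAction_uncurry ξ η

end SlodowyHamiltonian

end

theorem mainTheorem11
    {E : Type*} [NormedAddCommGroup E] [NormedSpace ℂ E] [FiniteDimensional ℂ E]
    {G : Type*} [TopologicalSpace G] [ChartedSpace E G] [Group G] [LieGroup 𝓘(ℂ, E) ω G]
    [SimplyConnectedSpace G]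
    [LieAlgebra.IsSemisimple ℂ (GroupLieAlgebra 𝓘(ℂ, E) G)]
    (ξ h η : GroupLieAlgebra 𝓘(ℂ, E) G) (hT : IsSl2TripleRel ξ h η) :
    IsHamiltonianAction E (slodowyForm ξ η) (slodowyAction ξ η) ∧
      IsMomentMap (slodowyForm ξ η) (slodowyAction ξ η) (slodowyMomentMap ξ η) :=
  -- Instance inference passes from semisimplicity to a nondegenerate Killing form, by Cartan's
  -- criterion.
  ⟨{ symplectic := isHolomorphicSymplectic_slodowyForm hT
     action := isHolomorphicAction_slodowyAction ξ η
     invariant := pullback_slodowyAction_slodowyForm ξ η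
     exists_momentMap := ⟨_, isMomentMap_slodowyMomentMap ξ η⟩ },
    isMomentMap_slodowyMomentMap ξ η⟩
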